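/- Let $K$ be a field of characteristic $0$ (for instance $\mathbb{C}$) and let $t=(t_1,t_2,\dots)$, $t'=(t'_1,t'_2,\dots)$ be two sequences of independent variables. For a partition $\lambda$ of length $\ell$ put $s_\lambda(t)=\det[h_{\lambda_i-i+j}(t)]_{1\le i,j\le \ell}$, where $\sum_{n\ge0}h_n(t)z^n=\gamma(z,t):=\exp\big(\sum_{n\ge1}t_nz^n\big)$ and $h_n=0$ for $n<0$; this is the Schur function $s_\lambda(x)$ written in terms of $t_k=\frac1k\sum_i x_i^k$. Let $Z=\sum_\lambda s_\lambda(t)s_\lambda(t')$, let $\mathfrak{M}(\lambda)=\frac1Z s_\lambda(t)s_\lambda(t')$ be the Schur measure, let $\mathfrak{S}(\lambda)=\{\lambda_i-i+\frac12 : i\ge1\}\subset\mathbb{Z}+\frac12$, and for an arbitrary (finite or infinite) set $X\subset\mathbb{Z}+\frac12$ let $\rho(X)=\sum_{\lambda:\,X\subset\mathfrak{S}(\lambda)}\mathfrak{M}(\lambda)$. All of these are formal power series in $t,t'$ over $K$. Theorem. For any $X\subset\mathbb{Z}+\frac12$ the sequence $\tau_n=Z\,\rho(X-n)$, $n\in\mathbb{Z}$,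 where $X-n=\{x-n: x\in X\}$, is a sequence of $\tau$-functions of the Ueno–Takasaki Toda lattice hierarchy (up to the change $t\to-t$), that is, it satisfies the Hirota bilinear equations: for all $m,l\in\mathbb{Z}$, $$[z^{l-m}]\,\gamma\big(\tfrac1z,-2s'\big)\,\tau_{m+1}(t+s,\,t'+s'+\{z\})\,\tau_l(t-s,\,t'-s'-\{z\})=[z^{m-l}]\,\gamma\big(\tfrac1z,2s\big)\,\tau_m(t+s-\{z\},\,t'+s')\,\tau_{l+1}(t-s+\{z\},\,t'-s')$$ as formal power series in four sequences of independent variables $t,t',s,s'$, where $\{z\}=(z,\frac{z^2}2,\frac{z^3}3,\dots)$ and $[z^k]$ denotes the coefficient of $z^k$. In particular, for every $n\in\mathbb{Z}$, $$\tau_n\,\frac{\partial^2\tau_n}{\partial t_1\,\partial t'_1}-\frac{\partial\tau_n}{\partial t_1}\,\frac{\partial\tau_n}{\partial t'_1}=\tau_{n+1}\,\tau_{n-1},$$ and, whenever $\tau_n\ne0$, $$\frac{\partial^2}{\partial t_1\,\partial t'_1}\log\tau_n=\frac{\tau_{n+1}\,\tau_{n-1}}{\tau_n^2}.$$ Here,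 for any $\tau_n\neq 0$, the left-hand side is understood as $\frac{\partial}{\partial t_1}\Big(\tau_n^{-1}\frac{\partial\tau_n}{\partial t'_1}\Big)$ in the field of fractions of $K[[t,t']]$; when $\tau_n$ has constant term $1$, the equation also holds in $K[[t,t']]$ with the formal logarithm $\log\tau_n=\sum_{k\ge1}\frac{(-1)^{k+1}}{k}(\tau_n-1)^k$. -/

import Mathlib

open MvPowerSeries

noncomputable section

namespace SchurToda

/-! ## Formal infinite sums of power series -/

section FormalSum

variable {σ ι K : Type*} [CommRing K]

/-- A family of formal power series is summable if every monomial occurs in only finitely many of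
its members. -/
def FormallySummable (f : ι → MvPowerSeries σ K) : Prop :=
  ∀ d : σ →₀ ℕ, {i | coeff d (f i) ≠ 0}.Finite

/-- The coefficientwise sum of a (summable) family of formal power series. -/
def formalSum (f : ι → MvPowerSeries σ K) : MvPowerSeries σ K :=
  fun d => ∑ᶠ i, coeff d (f i)

end FormalSum

/-! ## Complete homogeneous and Schur functions in the times `t₁, t₂, …` -/

section Schur

variable {A : Type*} [CommRing A] [Algebra ℚ A]

/-- The generating function `γ(z, t) = exp (∑_{n ≥ 1} tₙ zⁿ)`. -/
def gammaSeries (t : ℕ+ → A) : PowerSeries A :=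
  (PowerSeries.exp ℚ).subst
    (PowerSeries.mk fun n => if h : 0 < n then t ⟨n, h⟩ else 0 : PowerSeries A)

/-- The complete homogeneous function `hₙ(t) = [zⁿ] γ(z, t)`, which is `0` for `n < 0`. -/
def completeHomog (t : ℕ+ → A) (n : ℤ) : A :=
  if 0 ≤ n then PowerSeries.coeff n.toNat (gammaSeries t) else 0

/-- The Schur function `s_μ` as a polynomial in the times `t_k = p_k / k`
(`p_k` the power sums): `s_μ(t) = det [h_{μ_i - i + j}(t)]`, `1 ≤ i, j ≤ ℓ(μ)`. -/
def schur (t : ℕ+ → A) (μ : YoungDiagram) : A :=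
  Matrix.det (Matrix.of fun i j : Fin (μ.colLen 0) =>
    completeHomog t ((μ.rowLen i : ℤ) - (i : ℤ) + (j : ℤ)))

end Schur

section Homogeneity

variable {σ K : Type*} [Field K] [CharZero K] {w : σ → ℕ}

/-- The power series that are homogeneous of degree `n` for the weights `w`. -/
def homog (K : Type*) [Field K] [CharZero K] (w : σ → ℕ) (n : ℕ) :
    Submodule ℚ (MvPowerSeries σ K) where
  carrier := {f | ∀ d : σ →₀ ℕ, coeff d f ≠ 0 → Finsupp.weight w d = n}
  add_mem' := by
    intro f g hf hg d hd
    by_cases h : coeff d f = 0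
    · refine hg d fun h0 => hd ?_
      rw [map_add, h, h0, add_zero]
    · exact hf d h
  zero_mem' := by
    intro d hd
    simp at hd
  smul_mem' := by
    intro q f hf d hd
    refine hf d fun h0 => hd ?_
    rw [map_rat_smul (coeff (R := K) d), h0, smul_zero]

lemma one_mem_homog : (1 : MvPowerSeries σ K) ∈ homog K w 0 := by
  classical
  intro d hd
  rw [coeff_one] at hd
  have : d = 0 := by
    by_contra h
    simp [h] at hd
  simp [this]

lemma mul_mem_homog {f g : MvPowerSeries σ K} {m n : ℕ} (hf : f ∈ homog K w m)
    (hg : g ∈ homog K w n) : f * g ∈ homog K w (m + n) := by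
  intro d hd
  have hf' : f.IsWeightedHomogeneous w m := fun {d} h => hf d h
  have hg' : g.IsWeightedHomogeneous w n := fun {d} h => hg d h
  exact hf'.mul hg' hd

lemma prod_mem_homog {ι : Type*} (s : Finset ι) (f : ι → MvPowerSeries σ K) (e : ι → ℕ)
    (h : ∀ i ∈ s, f i ∈ homog K w (e i)) : ∏ i ∈ s, f i ∈ homog K w (∑ i ∈ s, e i) := by
  classical
  induction s using Finset.induction_on with
  | empty =>
    rw [Finset.prod_empty, Finset.sum_empty]
    exact one_mem_homog
  | insert a s ha ih =>
    rw [Finset.prod_insert ha, Finset.sum_insert ha]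
    exact mul_mem_homog (h a (Finset.mem_insert_self a s))
      (ih fun i hi => h i (Finset.mem_insert_of_mem hi))

lemma coeff_pow_mem_homog (f : PowerSeries (MvPowerSeries σ K))
    (hf : ∀ n, PowerSeries.coeff n f ∈ homog K w n) (k n : ℕ) :
    PowerSeries.coeff n (f ^ k) ∈ homog K w n := by
  induction k generalizing n with
  | zero =>
    rw [pow_zero, PowerSeries.coeff_one]
    split_ifs with h
    · subst h
      exact one_mem_homog
    · exact zero_mem _
  | succ k ih =>
    rw [pow_succ, PowerSeries.coeff_mul]
    refine sum_mem fun p hp => ?_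
    have hp' : p.1 + p.2 = n := by simpa using hp
    rw [← hp']
    exact mul_mem_homog (ih p.1) (hf p.2)

/-- If `t_k` is homogeneous of degree `k` for every `k`, then `h_n(t)` is so of degree `n`. -/
lemma completeHomog_mem_homog (t : ℕ+ → MvPowerSeries σ K)
    (ht : ∀ k : ℕ+, t k ∈ homog K w k) (n : ℤ) : completeHomog t n ∈ homog K w n.toNat := by
  unfold completeHomog
  split_ifs with hn
  · rw [gammaSeries, PowerSeries.coeff_subst' (PowerSeries.HasSubst.of_constantCoeff_zero' (by
      rw [← PowerSeries.coeff_zero_eq_constantCoeff_apply, PowerSeries.coeff_mk]; simp))]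
    refine finsum_induction (fun x => x ∈ homog K w n.toNat) (zero_mem _)
      (fun _ _ => add_mem) fun k => ?_
    refine Submodule.smul_mem _ _ (coeff_pow_mem_homog _ (fun m => ?_) _ _)
    rw [PowerSeries.coeff_mk]
    split_ifs with h
    · exact ht ⟨m, h⟩
    · exact zero_mem _
  · exact zero_mem _

lemma completeHomog_of_neg {A : Type*} [CommRing A] [Algebra ℚ A] (t : ℕ+ → A) {n : ℤ}
    (hn : n < 0) : completeHomog t n = 0 := by
  rw [completeHomog, if_neg (by omega)]

lemma sum_rowLen (μ : YoungDiagram) : ∑ i : Fin (μ.colLen 0), μ.rowLen i = μ.card := by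
  rw [Fin.sum_univ_eq_sum_range (fun i => μ.rowLen i), YoungDiagram.card,
    Finset.card_eq_sum_card_fiberwise (s := μ.cells) (f := Prod.fst)
      (t := Finset.range (μ.colLen 0))]
  · refine Finset.sum_congr rfl fun i _ => ?_
    rw [YoungDiagram.rowLen_eq_card]
    rfl
  · intro c hc
    refine Finset.mem_coe.mpr (Finset.mem_range.mpr (YoungDiagram.mem_iff_lt_colLen.mp ?_))
    exact μ.up_left_mem le_rfl (Nat.zero_le _) (YoungDiagram.mem_cells c |>.mp hc)

/-- If `t_k` is homogeneous of degree `k` for every `k`, then `s_μ(t)` is so of degree `|μ|`. -/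
lemma schur_mem_homog (t : ℕ+ → MvPowerSeries σ K)
    (ht : ∀ k : ℕ+, t k ∈ homog K w k) (μ : YoungDiagram) : schur t μ ∈ homog K w μ.card := by
  rw [schur, Matrix.det_apply]
  refine sum_mem fun p _ => ?_
  rw [Units.smul_def]
  refine zsmul_mem ?_ _
  change ∏ i, completeHomog t ((μ.rowLen (p i) : ℤ) - ((p i : ℕ) : ℤ) + ((i : ℕ) : ℤ)) ∈ _
  by_cases hneg : ∃ i : Fin (μ.colLen 0),
      (μ.rowLen (p i) : ℤ) - ((p i : ℕ) : ℤ) + ((i : ℕ) : ℤ) < 0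
  · obtain ⟨i, hi⟩ := hneg
    rw [Finset.prod_eq_zero (Finset.mem_univ i) (completeHomog_of_neg t hi)]
    exact zero_mem _
  · push Not at hneg
    have key := prod_mem_homog (w := w) Finset.univ
      (fun i => completeHomog t ((μ.rowLen (p i) : ℤ) - ((p i : ℕ) : ℤ) + ((i : ℕ) : ℤ)))
      _ (fun i _ => completeHomog_mem_homog t ht _)
    convert key using 2
    zify
    rw [Finset.sum_congr rfl fun i _ => Int.toNat_of_nonneg (hneg i), Finset.sum_add_distrib,
      Finset.sum_sub_distrib, Equiv.sum_comp p (fun i => ((μ.rowLen i : ℕ) : ℤ)),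
      Equiv.sum_comp p (fun i => (((i : Fin _) : ℕ) : ℤ)), sub_add_cancel, ← sum_rowLen]
    push_cast
    rfl

end Homogeneity

/-! ## The Schur measure and its correlation functions -/

/-- The two infinite sequences of independent variables `t` and `t'`. -/
inductive Time
  | t (k : ℕ+)
  | t' (k : ℕ+)

/-- The set `ℤ + 1/2`. -/
def halfIntegers : Set ℚ := Set.range fun k : ℤ => (k : ℚ) + 1 / 2

/-- `𝔖(μ) = {μ_i - i + 1/2 : i = 1, 2, …}`; here `μ.rowLen i` is `μ_{i+1}`. -/
def modifiedSet (μ : YoungDiagram) : Set ℚ :=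
  Set.range fun i : ℕ => (μ.rowLen i : ℚ) - ((i : ℚ) + 1) + 1 / 2

/-- The translate `X - n`. -/
def translate (X : Set ℚ) (n : ℤ) : Set ℚ := (fun x => x - (n : ℚ)) '' X

section Measure

variable (K : Type*) [Field K] [CharZero K]

/-- The product `s_μ(t) s_μ(t')`. -/
def schurWeight (μ : YoungDiagram) : MvPowerSeries Time K :=
  schur (fun k => X (Time.t k)) μ * schur (fun k => X (Time.t' k)) μ

/-- `Z = ∑_μ s_μ(t) s_μ(t')`. -/
def schurZ : MvPowerSeries Time K := formalSum fun μ : YoungDiagram => schurWeight K μ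

/-- The weights `deg t_k = k`, `deg t'_k = 0`. -/
def tDegree : Time → ℕ
  | .t k => k
  | .t' _ => 0

/-- The weights `deg t_k = 0`, `deg t'_k = k`. -/
def tDegree' : Time → ℕ
  | .t _ => 0
  | .t' k => k

variable {K} in
lemma X_mem_homog {σ : Type*} (w : σ → ℕ) (i : σ) : (X i : MvPowerSeries σ K) ∈ homog K w (w i) := by
  classical
  intro d hd
  rw [coeff_X] at hd
  have : d = Finsupp.single i 1 := by
    by_contra h
    simp [h] at hd
  rw [this, Finsupp.weight_single, one_smul]

lemma schurWeight_eq (μ : YoungDiagram) :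
    ∃ g f : MvPowerSeries Time K, f ∈ homog K tDegree μ.card ∧ schurWeight K μ = g * f :=
  ⟨schur (fun k => X (Time.t' k)) μ, schur (fun k => X (Time.t k)) μ,
    schur_mem_homog _ (fun k => X_mem_homog tDegree (Time.t k)) μ, mul_comm _ _⟩

variable {K} in
lemma le_weight_of_coeff_mul_ne_zero {σ : Type*} {w : σ → ℕ} {f g : MvPowerSeries σ K} {n : ℕ}
    (hf : f ∈ homog K w n) {d : σ →₀ ℕ} (hd : coeff d (g * f) ≠ 0) : n ≤ Finsupp.weight w d := by
  classical
  rw [coeff_mul] at hd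
  obtain ⟨p, hp, hne⟩ := Finset.exists_ne_zero_of_sum_ne_zero hd
  have hp' : p.1 + p.2 = d := by simpa using hp
  rw [← hp', map_add, hf p.2 (right_ne_zero_of_mul hne)]
  exact Nat.le_add_left _ _

lemma finite_card_le (n : ℕ) : {μ : YoungDiagram | μ.card ≤ n}.Finite := by
  refine Set.Finite.of_finite_image (f := YoungDiagram.cells)
    ((Finset.finite_toSet (Finset.range n ×ˢ Finset.range n).powerset).subset ?_)
    (fun μ _ ν _ h => YoungDiagram.ext h)
  rintro _ ⟨μ, hμ, rfl⟩
  rw [Finset.mem_coe, Finset.mem_powerset]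
  rintro ⟨i, j⟩ hc
  have hc' : (i, j) ∈ μ := (YoungDiagram.mem_cells _).mp hc
  have h1 : μ.rowLen i ≤ μ.card := by
    rw [YoungDiagram.rowLen_eq_card]
    exact Finset.card_le_card (Finset.filter_subset _ _)
  have h2 : μ.colLen j ≤ μ.card := by
    rw [YoungDiagram.colLen_eq_card]
    exact Finset.card_le_card (Finset.filter_subset _ _)
  have h3 := YoungDiagram.mem_iff_lt_rowLen.mp hc'
  have h4 := YoungDiagram.mem_iff_lt_colLen.mp hc'
  have h5 : μ.card ≤ n := hμ
  rw [Finset.mem_product, Finset.mem_range, Finset.mem_range]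
  exact ⟨by simpa using by omega, by simpa using by omega⟩

/-- The sum that defines `Z` is a summable family of power series. -/
lemma formallySummable_schurWeight : FormallySummable (schurWeight K) := by
  intro d
  refine (finite_card_le (Finsupp.weight tDegree d)).subset fun μ hμ => ?_
  obtain ⟨g, f, hf, h⟩ := schurWeight_eq K μ
  have hμ' : coeff d (schurWeight K μ) ≠ 0 := hμ
  rw [h] at hμ'
  exact le_weight_of_coeff_mul_ne_zero hf hμ'

/-- The constant term of `Z` is `1`, so that `Z` is invertible. -/
lemma constantCoeff_schurZ : constantCoeff (schurZ K) = 1 := by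
  have h0 : ∀ μ : YoungDiagram, μ ≠ ⊥ → coeff (0 : Time →₀ ℕ) (schurWeight K μ) = 0 := by
    intro μ hμ
    by_contra hne
    obtain ⟨g, f, hf, h⟩ := schurWeight_eq K μ
    rw [h] at hne
    have h1 := le_weight_of_coeff_mul_ne_zero hf hne
    rw [map_zero, Nat.le_zero, YoungDiagram.card, Finset.card_eq_zero] at h1
    exact hμ (YoungDiagram.ext h1)
  have hlen : (⊥ : YoungDiagram).colLen 0 = 0 := by
    rw [YoungDiagram.colLen_eq_card, Finset.card_eq_zero, YoungDiagram.col]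
    rfl
  have hdet : ∀ t : ℕ+ → MvPowerSeries Time K, schur t ⊥ = 1 := by
    intro t
    have : IsEmpty (Fin ((⊥ : YoungDiagram).colLen 0)) := by
      rw [hlen]
      infer_instance
    exact Matrix.det_isEmpty
  rw [← coeff_zero_eq_constantCoeff_apply]
  change ∑ᶠ μ, coeff (0 : Time →₀ ℕ) (schurWeight K μ) = 1
  rw [finsum_eq_single _ ⊥ h0, schurWeight, hdet, hdet, one_mul, coeff_zero_eq_constantCoeff_apply,
    map_one]

/-- The Schur measure `𝔐(μ) = Z⁻¹ s_μ(t) s_μ(t')`. -/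
def schurMeasure (μ : YoungDiagram) : MvPowerSeries Time K := (schurZ K)⁻¹ * schurWeight K μ

/-- Every subset of the set of partitions has a well defined measure. -/
lemma formallySummable_schurMeasure (P : YoungDiagram → Prop) :
    FormallySummable fun μ : {μ : YoungDiagram // P μ} => schurMeasure K μ := by
  intro d
  refine Set.Finite.of_finite_image (f := Subtype.val)
    ((finite_card_le (Finsupp.weight tDegree d)).subset ?_) Subtype.val_injective.injOn
  rintro _ ⟨μ, hμ, rfl⟩
  obtain ⟨g, f, hf, h⟩ := schurWeight_eq K μ.1
  have hμ' : coeff d (schurMeasure K μ.1) ≠ 0 := hμ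
  rw [schurMeasure, h, ← mul_assoc] at hμ'
  exact le_weight_of_coeff_mul_ne_zero hf hμ'

/-- The correlation function `ρ(X) = 𝔐({μ : X ⊆ 𝔖(μ)})`. -/
def correlation (X : Set ℚ) : MvPowerSeries Time K :=
  formalSum fun μ : {μ : YoungDiagram // X ⊆ modifiedSet μ} => schurMeasure K μ

/-- `τ_n = Z ρ(X - n)`. -/
def correlationTau (X : Set ℚ) (n : ℤ) : MvPowerSeries Time K :=
  schurZ K * correlation K (translate X n)

end Measure

/-! ## The Hirota equations of the Toda lattice hierarchy -/

/-- The variables `t, t', s, s'` of the Hirota equations. -/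
inductive HirotaVar
  | t (k : ℕ+)
  | t' (k : ℕ+)
  | s (k : ℕ+)
  | s' (k : ℕ+)

section Hirota

variable {K : Type*} [Field K] [CharZero K]

/-- The value `F(a, b)` of a power series `F(t, t')` at two sequences of power series. -/
def evalAt {σ : Type*} (F : MvPowerSeries Time K) (a b : ℕ+ → MvPowerSeries σ K) :
    MvPowerSeries σ K :=
  F.subst fun i : Time => match i with
    | .t k => a k
    | .t' k => b k

/-- For `F` in the variables `σ` and one more variable `z` (the index `none`), the coefficient
`[z^n] F`, `n ∈ ℤ`, a power series in the variables `σ`. -/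
def zCoeff {σ : Type*} (F : MvPowerSeries (Option σ) K) (n : ℤ) : MvPowerSeries σ K :=
  if 0 ≤ n then fun d => coeff (Finsupp.optionElim n.toNat d) F else 0

/-- The terms of the formal sum `[z^n] (γ(1/z, a) F(z)) = ∑_{j ∈ ℤ} h_{-j}(a) · [z^{n-j}] F(z)`;
note that `[z^j] γ(1/z, a) = h_{-j}(a)`. -/
def gammaInvMulTerm {σ : Type*} (n : ℤ) (a : ℕ+ → MvPowerSeries σ K)
    (F : MvPowerSeries (Option σ) K) (j : ℤ) : MvPowerSeries σ K :=
  completeHomog a (-j) * zCoeff F (n - j)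

/-- `[z^n] (γ(1/z, a) F(z))`. -/
def gammaInvMulCoeff {σ : Type*} (n : ℤ) (a : ℕ+ → MvPowerSeries σ K)
    (F : MvPowerSeries (Option σ) K) : MvPowerSeries σ K :=
  formalSum (gammaInvMulTerm n a F)

/-- The formal sum that defines `[z^n] (γ(1/z, c s) F(z))` is summable whenever `s = (s₁, s₂, …)`
is a sequence of distinct variables. -/
lemma formallySummable_gammaInvMulTerm {σ : Type*} (v : ℕ+ → σ) (hv : Function.Injective v)
    (c n : ℤ) (F : MvPowerSeries (Option σ) K) :
    FormallySummable (gammaInvMulTerm n (fun k => c • X (v k)) F) := by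
  classical
  intro d
  let w : σ → ℕ := fun i => if h : ∃ k, v k = i then h.choose else 0
  have hw : ∀ k, w (v k) = k := by
    intro k
    have h : ∃ l, v l = v k := ⟨k, rfl⟩
    simp only [w, dif_pos h]
    exact congrArg _ (hv h.choose_spec)
  refine (Set.finite_Icc (-(Finsupp.weight w d : ℤ)) 0).subset fun j hj => ?_
  have hj' : coeff d (gammaInvMulTerm n (fun k => c • X (v k)) F j) ≠ 0 := hj
  rw [gammaInvMulTerm, mul_comm] at hj'
  by_cases hpos : 0 < j
  · rw [completeHomog_of_neg _ (by omega), mul_zero, map_zero] at hj'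
    exact absurd rfl hj'
  · have h1 := le_weight_of_coeff_mul_ne_zero (w := w) (completeHomog_mem_homog _ (fun k => by
      have h := X_mem_homog (K := K) w (v k)
      rw [hw] at h
      exact zsmul_mem h c) (-j)) hj'
    exact Set.mem_Icc.mpr ⟨by omega, by omega⟩

variable (K)

/-- The sequence `{z} = (z, z²/2, z³/3, …)`. -/
def zSeq (k : ℕ+) : MvPowerSeries (Option HirotaVar) K :=
  ((k : ℕ) : K)⁻¹ • X none ^ (k : ℕ)

/-- The sequence of variables `t`. -/
def tSeq (k : ℕ+) : MvPowerSeries (Option HirotaVar) K := X (some (.t k))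

/-- The sequence of variables `t'`. -/
def tSeq' (k : ℕ+) : MvPowerSeries (Option HirotaVar) K := X (some (.t' k))

/-- The sequence of variables `s`. -/
def sSeq (k : ℕ+) : MvPowerSeries (Option HirotaVar) K := X (some (.s k))

/-- The sequence of variables `s'`. -/
def sSeq' (k : ℕ+) : MvPowerSeries (Option HirotaVar) K := X (some (.s' k))

variable {K}

/-- The Hirota bilinear equations of the Toda lattice hierarchy: for all `m, l ∈ ℤ`,
`[z^{l-m}] γ(1/z, -2s') τ_{m+1}(t+s, t'+s'+{z}) τ_l(t-s, t'-s'-{z})`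
`= [z^{m-l}] γ(1/z, 2s) τ_m(t+s-{z}, t'+s') τ_{l+1}(t-s+{z}, t'-s')`
as formal power series in `t, t', s, s'`. -/
def SatisfiesTodaHirota (τ : ℤ → MvPowerSeries Time K) : Prop :=
  ∀ m l : ℤ,
    gammaInvMulCoeff (l - m) (fun k => (-2 : ℤ) • X (HirotaVar.s' k))
      (evalAt (τ (m + 1)) (tSeq K + sSeq K) (tSeq' K + sSeq' K + zSeq K) *
        evalAt (τ l) (tSeq K - sSeq K) (tSeq' K - sSeq' K - zSeq K)) =
    gammaInvMulCoeff (m - l) (fun k => (2 : ℤ) • X (HirotaVar.s k))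
      (evalAt (τ m) (tSeq K + sSeq K - zSeq K) (tSeq' K + sSeq' K) *
        evalAt (τ (l + 1)) (tSeq K - sSeq K + zSeq K) (tSeq' K - sSeq' K))

end Hirota

/-! ## Logarithmic derivatives -/

section Derivatives

variable {K R : Type*} [Field K] [CommRing R] [Algebra K R]
  (F : Type*) [Field F] [Algebra R F] [IsFractionRing R F]

/-- The ring homomorphism `f ↦ f + D(f) ε` into the dual numbers over the field of fractions. -/
def dualHom (D : Derivation K R R) :
    R →+* TrivSqZeroExt F F where
  toFun f := (algebraMap R F f, algebraMap R F (D f))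
  map_one' := by
    ext
    · exact map_one _
    · change algebraMap R F (D 1) = 0
      rw [D.map_one_eq_zero, map_zero]
  map_mul' f g := by
    ext
    · exact map_mul _ f g
    · change algebraMap R F (D (f * g)) =
        algebraMap R F f * algebraMap R F (D g) +
          algebraMap R F (D f) * algebraMap R F g
      rw [D.leibniz, smul_eq_mul, smul_eq_mul, map_add, map_mul, map_mul]
      ring
  map_zero' := by
    ext
    · exact map_zero _
    · change algebraMap R F (D 0) = 0
      rw [map_zero, map_zero]
  map_add' f g := by
    ext
    · exact map_add _ f g
    · change algebraMap R F (D (f + g)) =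
        algebraMap R F (D f) + algebraMap R F (D g)
      rw [map_add, map_add]

/-- The extension of `dualHom F D` to the field of fractions. -/
def fracDualHom (D : Derivation K R R) :
    F →+* TrivSqZeroExt F F :=
  IsLocalization.lift (M := nonZeroDivisors R) (g := dualHom F D) (by
    intro y
    rw [TrivSqZeroExt.isUnit_iff_isUnit_fst]
    change IsUnit (algebraMap R F y)
    exact IsLocalization.map_units _ y)

lemma fracDualHom_algebraMap (D : Derivation K R R) (f : R) :
    fracDualHom F D (algebraMap R F f) = dualHom F D f :=
  IsLocalization.lift_eq _ f

lemma fst_fracDualHom (D : Derivation K R R) (x : F) :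
    (fracDualHom F D x).fst = x := by
  have h : (TrivSqZeroExt.fstHom ℤ F F).toRingHom.comp
      (fracDualHom F D) = RingHom.id _ := by
    apply IsLocalization.ringHom_ext (nonZeroDivisors R)
    ext f
    change (fracDualHom F D (algebraMap R F f)).fst = _
    rw [fracDualHom_algebraMap]
    rfl
  exact congrArg (fun φ : F →+* F => φ x) h

variable [Algebra K F] [IsScalarTower K R F]

/-- The unique derivation of the field of fractions that extends the derivation `D`. -/
def fracDeriv (D : Derivation K R R) : Derivation K F F :=
  Derivation.mk'
    { toFun := fun x => (fracDualHom F D x).snd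
      map_add' := fun x y => by rw [map_add, TrivSqZeroExt.snd_add]
      map_smul' := fun c x => by
        rw [Algebra.smul_def, IsScalarTower.algebraMap_apply K R F, map_mul,
          TrivSqZeroExt.snd_mul, fst_fracDualHom, fst_fracDualHom, fracDualHom_algebraMap]
        change algebraMap R F (algebraMap K R c) * _ +
          MulOpposite.op x • algebraMap R F (D (algebraMap K R c)) = _
        rw [D.map_algebraMap, map_zero, smul_zero, add_zero, RingHom.id_apply, Algebra.smul_def,
          IsScalarTower.algebraMap_apply K R F] }
    (fun x y => by
      change (fracDualHom F D (x * y)).snd =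
        x * (fracDualHom F D y).snd + y * (fracDualHom F D x).snd
      rw [map_mul, TrivSqZeroExt.snd_mul, fst_fracDualHom, fst_fracDualHom, smul_eq_mul,
        op_smul_eq_mul, mul_comm (TrivSqZeroExt.snd _) y])

lemma fracDeriv_algebraMap (D : Derivation K R R) (f : R) :
    fracDeriv F D (algebraMap R F f) = algebraMap R F (D f) := by
  change (fracDualHom F D (algebraMap R F f)).snd = _
  rw [fracDualHom_algebraMap]
  rfl

end Derivatives

section TodaEquation

variable (K : Type*) [Field K] [CharZero K]

/-- `∂/∂t₁`. -/
abbrev dt : Derivation K (MvPowerSeries Time K) (MvPowerSeries Time K) :=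
  pderiv K (Time.t 1)

/-- `∂/∂t'₁`. -/
abbrev dt' : Derivation K (MvPowerSeries Time K) (MvPowerSeries Time K) :=
  pderiv K (Time.t' 1)

variable {K}

/-- `∂²(log f)/∂t₁∂t'₁ = ∂/∂t₁ (f⁻¹ ∂f/∂t'₁)` in the field of fractions of the ring of power
series, for `f ≠ 0`. -/
def mixedLogDeriv (f : MvPowerSeries Time K) : FractionRing (MvPowerSeries Time K) :=
  fracDeriv _ (dt K)
    (fracDeriv _ (dt' K) (algebraMap _ _ f) / algebraMap _ (FractionRing (MvPowerSeries Time K)) f)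

/-- The power series `log f = ∑_{n ≥ 1} (-1)^{n+1} (f - 1)^n / n`, for `f` with constant
term `1`. -/
def logSeries (f : MvPowerSeries Time K) : MvPowerSeries Time K :=
  (PowerSeries.log ℚ).subst (f - 1)

end TodaEquation

end SchurToda

end

open SchurToda

/-! Shifted by a charge `n`, a partition μ becomes the decreasing sequence f_i = μ_i - i + n, i ≥ 0.
Since `Z` cancels its inverse in the measure, τ_n is the sum of s_f(t) s_f(t') over the sequences f
of charge `n` that contain X + 1/2 (`hasSum_correlationTau`). In fermionic terms, Σ_k ψ_k ⊗ ψ_k^*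
commutes with the tensor square of the projection onto the sequences containing X + 1/2; the proof
makes this combinatorial.

A transfer moves an element k ∉ f from g to f, so a pair (f, g) of charges (m, l+1) becomes (f ∪ k,
g ∖ k) of charges (m+1, l). Both pairs have the same intersection, hence satisfy the condition on X
together (`indicator_source_eq_target`). The algebraic input is the identity [z^{m-l}] γ(1/z, a-b)
s_f(a-{z}) s_g(b+{z}) = Σ_k ± s_{f ∪ k}(a) s_{g ∖ k}(b) (`Transfer.finsum_schurFun_mul`,
`gammaInvMulHom_schurFun_mul`). To see it, expand s_{f ∪ k}(a) along the row of k. The sum over k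
becomes a determinant with one extra column of functions h(a); the addition formula for a = (a-b) +
b rewrites this column through columns h(b), and those that repeat an existing column drop out. What
remains is the product of the expansions of s_f(a-{z}) and s_g(b+{z}) in powers of z.

Hence, with a, b = t ± s and a', b' = t' ± s', the right side of the Hirota equation is the sum over
all transfers of ± s_f(a') s_g(b') s_{f ∪ k}(a) s_{g ∖ k}(b), restricted by X. The left side is the
same sum, obtained from the inverse transfers with t and t' exchanged.

The Toda equation comes from the same determinantal identity over the dual numbers, where {ε} = (ε,
0, 0, …) and translation by {ε} is differentiation in the first time. A single sum over transfers
from charges (n, n) to (n+1, n-1) gives its two sides when grouped by source and by target. The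
logarithmic forms then follow from the quotient rule. -/

namespace SchurToda

open scoped MvPowerSeries.WithPiTopology

/-! ### Complete homogeneous functions: addition of times and translation by {w}. -/

section CompleteHomog

variable {A : Type*} [CommRing A]

/-- The series `∑_{n ≥ 1} tₙ zⁿ`. -/
noncomputable def timeSeries (t : ℕ+ → A) : PowerSeries A :=
  PowerSeries.mk fun n => if h : 0 < n then t ⟨n, h⟩ else 0

lemma hasSubst_timeSeries (t : ℕ+ → A) : PowerSeries.HasSubst (timeSeries t) :=
  PowerSeries.HasSubst.of_constantCoeff_zero' (by
    rw [← PowerSeries.coeff_zero_eq_constantCoeff_apply, timeSeries, PowerSeries.coeff_mk]; simp)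

lemma coeff_derivative_timeSeries (t : ℕ+ → A) (n : ℕ) :
    PowerSeries.coeff n (PowerSeries.derivative A (timeSeries t)) =
      ((n + 1 : ℕ) : A) * t n.succPNat := by
  rw [PowerSeries.coeff_derivative, timeSeries, PowerSeries.coeff_mk, dif_pos (Nat.succ_pos n),
    mul_comm]
  push_cast
  rfl

lemma timeSeries_add (a b : ℕ+ → A) : timeSeries (a + b) = timeSeries a + timeSeries b := by
  ext n
  simp only [timeSeries, PowerSeries.coeff_mk, map_add]
  split_ifs
  · rfl
  · rw [add_zero]

/-- The sequence `u = {w} = (w, w²/2, w³/3, …)`. -/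
def IsPowerSeq (u : ℕ+ → A) (w : A) : Prop := ∀ k : ℕ+, ((k : ℕ) : A) * u k = w ^ (k : ℕ)

variable [Algebra ℚ A]

/-- Exponentiating over `A` instead of ℚ makes the chain rule for `PowerSeries.derivative A`
applicable. -/
lemma gammaSeries_eq (t : ℕ+ → A) :
    gammaSeries t = (PowerSeries.exp A).subst (timeSeries t) := by
  ext n
  rw [gammaSeries, ← timeSeries, PowerSeries.coeff_subst' (hasSubst_timeSeries t),
    PowerSeries.coeff_subst' (hasSubst_timeSeries t)]
  refine finsum_congr fun d => ?_
  rw [PowerSeries.coeff_exp, PowerSeries.coeff_exp, Algebra.algebraMap_self, RingHom.id_apply,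
    smul_eq_mul, Algebra.smul_def]

lemma constantCoeff_gammaSeries (t : ℕ+ → A) :
    PowerSeries.constantCoeff (gammaSeries t) = 1 := by
  rw [gammaSeries_eq, ← PowerSeries.coeff_zero_eq_constantCoeff_apply,
    PowerSeries.coeff_subst' (hasSubst_timeSeries t), finsum_eq_single _ 0]
  · simp
  · intro n hn
    rw [PowerSeries.coeff_zero_eq_constantCoeff_apply, map_pow,
      ← PowerSeries.coeff_zero_eq_constantCoeff_apply, timeSeries, PowerSeries.coeff_mk]
    simp [hn]

lemma derivative_gammaSeries (t : ℕ+ → A) :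
    PowerSeries.derivative A (gammaSeries t) =
      gammaSeries t * PowerSeries.derivative A (timeSeries t) := by
  rw [gammaSeries_eq, PowerSeries.derivative_subst (hasSubst_timeSeries t),
    PowerSeries.derivative_exp]

/-- `γ(z, t)` is the only solution of its differential equation. -/
lemma eq_gammaSeries {t : ℕ+ → A} {G : PowerSeries A} (h0 : PowerSeries.constantCoeff G = 1)
    (hG : PowerSeries.derivative A G = G * PowerSeries.derivative A (timeSeries t)) :
    G = gammaSeries t := by
  -- `A` may have zero divisors, but n + 1 is a unit because `A` is a ℚ-algebra; so the equation
  -- determines the coefficients recursively.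
  have inj : ∀ (n : ℕ) (x y : A), x * ((n : A) + 1) = y * ((n : A) + 1) → x = y := by
    intro n x y h
    have hu : IsUnit ((n : A) + 1) := by
      have := (IsUnit.mk0 ((n : ℚ) + 1) (by positivity)).map (algebraMap ℚ A)
      simpa using this
    exact hu.mul_right_cancel h
  ext n
  induction n using Nat.strong_induction_on with
  | _ n ih =>
    rcases n with _ | n
    · rw [PowerSeries.coeff_zero_eq_constantCoeff_apply, h0,
        PowerSeries.coeff_zero_eq_constantCoeff_apply, constantCoeff_gammaSeries]
    · refine inj n _ _ ?_
      rw [← PowerSeries.coeff_derivative, ← PowerSeries.coeff_derivative, hG,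
        derivative_gammaSeries, PowerSeries.coeff_mul, PowerSeries.coeff_mul]
      refine Finset.sum_congr rfl fun p hp => ?_
      have hp' : p.1 + p.2 = n := by simpa using hp
      rw [ih p.1 (by omega)]

/-- By the Leibniz rule the product solves the differential equation of γ(z, a + b); uniqueness
avoids manipulating the exponential series. -/
lemma gammaSeries_add (a b : ℕ+ → A) :
    gammaSeries (a + b) = gammaSeries a * gammaSeries b := by
  symm
  refine eq_gammaSeries ?_ ?_
  · rw [map_mul, constantCoeff_gammaSeries, constantCoeff_gammaSeries, one_mul]
  · rw [Derivation.leibniz, timeSeries_add, map_add, derivative_gammaSeries,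
      derivative_gammaSeries, smul_eq_mul, smul_eq_mul]
    ring

lemma map_gammaSeries {B : Type*} [CommRing B] [Algebra ℚ B] (φ : A →+* B) (t : ℕ+ → A) :
    PowerSeries.map φ (gammaSeries t) = gammaSeries fun k => φ (t k) := by
  have hD : ∀ F : PowerSeries A, PowerSeries.derivative B (PowerSeries.map φ F) =
      PowerSeries.map φ (PowerSeries.derivative A F) := by
    intro F
    ext n
    simp [PowerSeries.coeff_derivative]
  have hT : PowerSeries.map φ (timeSeries t) = timeSeries fun k => φ (t k) := by
    ext n
    simp only [timeSeries, PowerSeries.coeff_mk, PowerSeries.coeff_map]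
    split_ifs <;> simp
  refine eq_gammaSeries ?_ ?_
  · rw [← PowerSeries.coeff_zero_eq_constantCoeff_apply, PowerSeries.coeff_map,
      PowerSeries.coeff_zero_eq_constantCoeff_apply, constantCoeff_gammaSeries, map_one]
  · rw [hD, derivative_gammaSeries, map_mul, ← hT, hD]

lemma map_completeHomog {B : Type*} [CommRing B] [Algebra ℚ B] (φ : A →+* B) (t : ℕ+ → A)
    (n : ℤ) : φ (completeHomog t n) = completeHomog (fun k => φ (t k)) n := by
  rw [completeHomog, completeHomog, ← map_gammaSeries, PowerSeries.coeff_map]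
  split_ifs <;> simp

lemma map_schur {B : Type*} [CommRing B] [Algebra ℚ B] (φ : A →+* B) (t : ℕ+ → A)
    (μ : YoungDiagram) : φ (schur t μ) = schur (fun k => φ (t k)) μ := by
  rw [schur, schur, RingHom.map_det]
  congr 1
  ext i j
  exact map_completeHomog φ t _

lemma completeHomog_zero_index (t : ℕ+ → A) : completeHomog t 0 = 1 := by
  rw [completeHomog, if_pos le_rfl, Int.toNat_zero, PowerSeries.coeff_zero_eq_constantCoeff_apply,
    constantCoeff_gammaSeries]

lemma completeHomog_natCast (t : ℕ+ → A) (n : ℕ) :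
    completeHomog t n = PowerSeries.coeff n (gammaSeries t) := by
  rw [completeHomog, if_pos (Int.natCast_nonneg n), Int.toNat_natCast]

/-- The addition formula `h_n(b + c) = ∑ᵢ hᵢ(c) h_{n-i}(b)`, in a shifted form. -/
lemma completeHomog_add (b c : ℕ+ → A) (n e : ℤ) (s : Finset ℤ)
    (hs : ∀ y, -n ≤ y → y ≤ e → y ∈ s) :
    completeHomog (b + c) (n + e) =
      ∑ y ∈ s, completeHomog c (e - y) * completeHomog b (n + y) := by
  classical
  by_cases hne : n + e < 0
  · rw [completeHomog_of_neg _ hne]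
    symm
    refine Finset.sum_eq_zero fun y _ => ?_
    by_cases hy : e < y
    · rw [completeHomog_of_neg _ (by omega), zero_mul]
    · rw [completeHomog_of_neg b (by omega), mul_zero]
  · obtain ⟨N, hN⟩ := Int.eq_ofNat_of_zero_le (not_lt.mp hne)
    rw [hN, completeHomog_natCast, gammaSeries_add, PowerSeries.coeff_mul]
    symm
    refine (Finset.sum_of_injOn (fun p : ℕ × ℕ => (p.1 : ℤ) - n) ?_ ?_ ?_ ?_).symm
    · intro p hp q hq hpq
      have hp' : p.1 + p.2 = N := by simpa using hp
      have hq' : q.1 + q.2 = N := by simpa using hq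
      have : (p.1 : ℤ) - n = q.1 - n := hpq
      ext <;> omega
    · intro p hp
      have hp' : p.1 + p.2 = N := by simpa using hp
      exact hs _ (by dsimp only; omega) (by dsimp only; omega)
    · intro y _ hy
      by_cases hy1 : e < y
      · rw [completeHomog_of_neg _ (by omega), zero_mul]
      · by_cases hy2 : n + y < 0
        · rw [completeHomog_of_neg b hy2, mul_zero]
        · refine absurd ⟨((n + y).toNat, (e - y).toNat), ?_, ?_⟩ hy
          · rw [Finset.mem_coe, Finset.HasAntidiagonal.mem_antidiagonal]
            omega
          · dsimp only
            omega
    · intro p hp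
      have hp' : p.1 + p.2 = N := by simpa using hp
      rw [show e - ((p.1 : ℤ) - n) = p.2 by omega, show n + ((p.1 : ℤ) - n) = p.1 by omega,
        completeHomog_natCast, completeHomog_natCast, mul_comm]

/-- The geometric series 1/(1 - wz) has logarithmic derivative Σ w^{n+1} zⁿ, which is the derivative
of the time series of {w}. -/
lemma gammaSeries_of_isPowerSeq {u : ℕ+ → A} {w : A} (hu : IsPowerSeq u w) :
    gammaSeries u = PowerSeries.mk fun n => w ^ n := by
  symm
  refine eq_gammaSeries (by simp [← PowerSeries.coeff_zero_eq_constantCoeff_apply]) ?_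
  ext n
  rw [PowerSeries.coeff_derivative, PowerSeries.coeff_mk, PowerSeries.coeff_mul,
    Finset.sum_congr rfl (g := fun _ => w ^ (n + 1)), Finset.sum_const,
    Finset.Nat.card_antidiagonal, nsmul_eq_mul, mul_comm]
  · push_cast
    rfl
  · intro p hp
    have hp' : p.1 + p.2 = n := by simpa using hp
    have h := hu p.2.succPNat
    rw [Nat.succPNat_coe] at h
    rw [PowerSeries.coeff_mk, coeff_derivative_timeSeries, ← Nat.succ_eq_add_one, h, ← pow_add,
      ← hp', Nat.succ_eq_add_one, add_assoc]

lemma completeHomog_of_isPowerSeq {u : ℕ+ → A} {w : A} (hu : IsPowerSeq u w) (n : ℕ) :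
    completeHomog u n = w ^ n := by
  rw [completeHomog_natCast, gammaSeries_of_isPowerSeq hu, PowerSeries.coeff_mk]

/-- `h_n(t - {w}) = h_n(t) - w h_{n-1}(t)`. -/
lemma completeHomog_sub_powerSeq (t : ℕ+ → A) {u : ℕ+ → A} {w : A} (hu : IsPowerSeq u w) (n : ℤ) :
    completeHomog (t - u) n = completeHomog t n - w * completeHomog t (n - 1) := by
  -- Translation by -{w} multiplies γ by 1 - wz, the inverse of γ(z, {w}).
  have h1 : gammaSeries (t - u) = gammaSeries t * (1 - PowerSeries.C w * PowerSeries.X) := by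
    have h2 : gammaSeries t = gammaSeries (t - u) * gammaSeries u := by
      rw [← gammaSeries_add, sub_add_cancel]
    have h3 : gammaSeries u * (1 - PowerSeries.C w * PowerSeries.X) = 1 := by
      rw [gammaSeries_of_isPowerSeq hu]
      ext n
      rw [mul_sub, mul_one, ← mul_assoc, map_sub, PowerSeries.coeff_mk]
      rcases n with _ | n
      · simp
      · rw [PowerSeries.coeff_succ_mul_X, PowerSeries.coeff_mul_C, PowerSeries.coeff_mk,
          PowerSeries.coeff_one, if_neg (Nat.succ_ne_zero n), pow_succ, sub_self]
    rw [h2, mul_assoc, h3, mul_one]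
  rcases lt_or_ge n 0 with hn | hn
  · rw [completeHomog_of_neg _ hn, completeHomog_of_neg _ hn, completeHomog_of_neg _ (by omega)]
    simp
  · obtain ⟨n, rfl⟩ := Int.eq_ofNat_of_zero_le hn
    rw [completeHomog_natCast, completeHomog_natCast, h1, mul_sub, mul_one, map_sub, ← mul_assoc]
    rcases n with _ | n
    · rw [completeHomog_of_neg _ (by norm_num)]
      simp
    · rw [PowerSeries.coeff_succ_mul_X, PowerSeries.coeff_mul_C, Nat.cast_add_one,
        add_sub_cancel_right, completeHomog_natCast, mul_comm w]

/-- `h_n(t + {w}) = h_n(t) + w h_{n-1}(t + {w})`. -/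
lemma completeHomog_add_powerSeq (t : ℕ+ → A) {u : ℕ+ → A} {w : A} (hu : IsPowerSeq u w) (n : ℤ) :
    completeHomog (t + u) n = completeHomog t n + w * completeHomog (t + u) (n - 1) := by
  have h := completeHomog_sub_powerSeq (t + u) hu n
  rw [add_sub_cancel_right] at h
  rw [h, sub_add_cancel]

/-- `h_n(t + {w}) = ∑_{r ≥ 0} w^r h_{n-r}(t)`. -/
lemma completeHomog_add_powerSeq_eq_sum (t : ℕ+ → A) {u : ℕ+ → A} {w : A} (hu : IsPowerSeq u w)
    {n : ℤ} {K : ℕ} (hK : n < K) :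
    completeHomog (t + u) n = ∑ r ∈ Finset.range K, w ^ r * completeHomog t (n - r) := by
  -- Iterating the one-step recursion leaves a remainder with h_{n-K}, which vanishes once K > n.
  have h : ∀ K : ℕ, completeHomog (t + u) n = (∑ r ∈ Finset.range K, w ^ r *
      completeHomog t (n - r)) + w ^ K * completeHomog (t + u) (n - K) := by
    intro K
    induction K with
    | zero => simp
    | succ K ih =>
      rw [ih, Finset.sum_range_succ, completeHomog_add_powerSeq t hu (n - K)]
      push_cast
      rw [sub_sub]
      ring
  rw [h K, completeHomog_of_neg (t + u) (by omega), mul_zero, add_zero]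

end CompleteHomog

/-- The sequence `g` without its `q`-th term. -/
def eraseSeq (g : ℕ → ℤ) (q : ℕ) (i : ℕ) : ℤ := if i < q then g i else g (i + 1)

lemma eraseSeq_eq_succAbove (g : ℕ → ℤ) {N : ℕ} (q : Fin (N + 1)) (i : Fin N) :
    eraseSeq g q i = g (q.succAbove i : Fin (N + 1)) := by
  unfold eraseSeq Fin.succAbove
  simp only [Fin.lt_def, Fin.val_castSucc]
  split_ifs <;> simp

/-! ### Jacobi–Trudi determinants and their bilinear identity. -/

section Determinants

variable {A : Type*} [CommRing A] [Algebra ℚ A]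

/-- The determinant `det [h_{f_i - m + j}(t)]`, `0 ≤ i, j < N`. -/
noncomputable def detH (t : ℕ+ → A) (m : ℤ) (N : ℕ) (f : ℕ → ℤ) : A :=
  Matrix.det (Matrix.of fun i j : Fin N => completeHomog t (f i - m + (j : ℕ)))

/-- The minor of the `N × (N + 1)` matrix `[h_{f_i - m - 1 + k}(t)]` without the column `j`. -/
noncomputable def minorH (t : ℕ+ → A) (m : ℤ) (N : ℕ) (f : ℕ → ℤ) (j : Fin (N + 1)) : A :=
  Matrix.det (Matrix.of fun i k : Fin N =>
    completeHomog t (f i - m - 1 + ((j.succAbove k : Fin (N + 1)) : ℕ)))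

/-- The determinant of `[v, h_{g_i - l + j}(b)]`, `0 ≤ i ≤ N`, `0 ≤ j < N`. -/
noncomputable def colDet (b : ℕ+ → A) (l : ℤ) (N : ℕ) (g : ℕ → ℤ) (v : ℕ → A) : A :=
  Matrix.det (Matrix.of fun i j : Fin (N + 1) =>
    Fin.cases (motive := fun _ => A) (v i) (fun k : Fin N => completeHomog b (g i - l + (k : ℕ))) j)

/-- Laplace expansion along the free column. It turns alternating sums over the removed element of
`g` into one determinant, linear in `v`. -/
lemma colDet_eq_sum (b : ℕ+ → A) (l : ℤ) (N : ℕ) (g : ℕ → ℤ) (v : ℕ → A) :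
    colDet b l N g v =
      ∑ q ∈ Finset.range (N + 1), (-1) ^ q * v q * detH b l N (eraseSeq g q) := by
  rw [colDet, Matrix.det_succ_column_zero, ← Fin.sum_univ_eq_sum_range
    (fun q => (-1) ^ q * v q * detH b l N (eraseSeq g q))]
  refine Finset.sum_congr rfl fun q _ => ?_
  congr 1
  rw [detH]
  congr 1
  ext i j
  simp [eraseSeq_eq_succAbove]

lemma colDet_sum {ι : Type*} (b : ℕ+ → A) (l : ℤ) (N : ℕ) (g : ℕ → ℤ) (s : Finset ι)
    (x : ι → A) (v : ι → ℕ → A) :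
    colDet b l N g (fun q => ∑ y ∈ s, x y * v y q) = ∑ y ∈ s, x y * colDet b l N g (v y) := by
  simp only [colDet_eq_sum, Finset.mul_sum, Finset.sum_mul]
  rw [Finset.sum_comm]
  refine Finset.sum_congr rfl fun y _ => Finset.sum_congr rfl fun q _ => ?_
  ring

lemma colDet_congr (b : ℕ+ → A) (l : ℤ) (N : ℕ) (g : ℕ → ℤ) {v v' : ℕ → A}
    (h : ∀ q ≤ N, v q = v' q) : colDet b l N g v = colDet b l N g v' := by
  rw [colDet_eq_sum, colDet_eq_sum]
  refine Finset.sum_congr rfl fun q hq => ?_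
  rw [h q (Nat.lt_succ_iff.mp (Finset.mem_range.mp hq))]

lemma colDet_eq_zero_of_repeated (b : ℕ+ → A) (l : ℤ) {N : ℕ} (g : ℕ → ℤ) (k : ℕ) (hk : k < N) :
    colDet b l N g (fun q => completeHomog b (g q - l + k)) = 0 :=
  Matrix.det_zero_of_column_eq (i := 0) (j := (⟨k, hk⟩ : Fin N).succ) (Fin.succ_ne_zero _).symm
    fun _ => rfl

/-- The coefficient of `w^r` in `det [h_{g_i - l - 1 + j}(b + {w})]`. -/
noncomputable def colH (b : ℕ+ → A) (l : ℤ) (N : ℕ) (g : ℕ → ℤ) (r : ℕ) : A :=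
  colDet b l N g fun q => completeHomog b (g q - (l + 1) - r)

lemma detH_add_powerSeq (b : ℕ+ → A) {u : ℕ+ → A} {w : A} (hu : IsPowerSeq u w) (l : ℤ) (N : ℕ)
    (g : ℕ → ℤ) (K : ℕ) (hK : ∀ q ≤ N, g q - (l + 1) < K) :
    detH (b + u) (l + 1) (N + 1) g = ∑ r ∈ Finset.range K, w ^ r * colH b l N g r := by
  have h1 : detH (b + u) (l + 1) (N + 1) g =
      colDet b l N g fun q => completeHomog (b + u) (g q - (l + 1)) := by
    -- Subtracting w times the preceding column replaces b + {w} by b in every column except the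
    -- first, so only the first still depends on w.
    refine Matrix.det_eq_of_forall_col_eq_smul_add_pred (fun _ => w) (fun i => ?_) fun i j => ?_
    · simp
    · simp only [Matrix.of_apply, Fin.cases_succ, Fin.val_succ, Fin.val_castSucc]
      rw [completeHomog_add_powerSeq b hu]
      push_cast
      rw [show g i - (l + 1) + ((j : ℤ) + 1) = g i - l + j by ring,
        show g i - l + (j : ℤ) - 1 = g i - (l + 1) + j by ring]
  rw [h1]
  unfold colH
  rw [← colDet_sum]
  exact colDet_congr b l N g fun q hq => completeHomog_add_powerSeq_eq_sum b hu (hK q hq)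

lemma detH_sub_powerSeq (a : ℕ+ → A) {u : ℕ+ → A} {w : A} (hu : IsPowerSeq u w) (m : ℤ) (N : ℕ)
    (f : ℕ → ℤ) :
    detH (a - u) m N f = ∑ j : Fin (N + 1), (-w) ^ (j : ℕ) * minorH a m N f j := by
  -- `P` is bordered by the row (1, w, w², …). Subtracting w times each column from the next turns
  -- this row into (1, 0, …, 0) and `a` into a - {w} in the later columns, which is `Q`. Expanding
  -- both along the first row gives the two sides.
  let P : Matrix (Fin (N + 1)) (Fin (N + 1)) A := Matrix.of fun i j =>
    Fin.cases (motive := fun _ => A) (w ^ (j : ℕ))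
      (fun i' : Fin N => completeHomog a (f i' - m - 1 + (j : ℕ))) i
  let Q : Matrix (Fin (N + 1)) (Fin (N + 1)) A := Matrix.of fun i j =>
    Fin.cases (motive := fun _ => A) (if j = 0 then 1 else 0)
      (fun i' : Fin N => if j = 0 then completeHomog a (f i' - m - 1)
        else completeHomog (a - u) (f i' - m - 1 + (j : ℕ))) i
  have hPQ : P.det = Q.det := by
    refine Matrix.det_eq_of_forall_col_eq_smul_add_pred (fun _ => w) (fun i => ?_) fun i j => ?_
    · refine Fin.cases ?_ (fun i' => ?_) i
      · simp [P, Q]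
      · simp [P, Q]
    · refine Fin.cases ?_ (fun i' => ?_) i
      · simp [P, Q, pow_succ, mul_comm]
      · simp only [P, Q, Matrix.of_apply, Fin.cases_succ, Fin.val_succ, Fin.val_castSucc,
          Fin.succ_ne_zero, if_false]
        rw [completeHomog_sub_powerSeq a hu]
        push_cast
        rw [show f i' - m - 1 + ((j : ℤ) + 1) - 1 = f i' - m - 1 + j by ring, sub_add_cancel]
  have hP : P.det = ∑ j : Fin (N + 1), (-w) ^ (j : ℕ) * minorH a m N f j := by
    rw [Matrix.det_succ_row_zero]
    refine Finset.sum_congr rfl fun j _ => ?_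
    rw [neg_pow w]
    rfl
  have hQ : Q.det = detH (a - u) m N f := by
    rw [Matrix.det_succ_row_zero, Finset.sum_eq_single 0]
    · simp only [Q, Fin.val_zero, pow_zero, Matrix.of_apply, Fin.cases_zero, if_true, one_mul]
      rw [detH]
      congr 1
      ext i j
      simp only [Matrix.submatrix_apply, Matrix.of_apply, Fin.cases_succ, Fin.succAbove_zero,
        Fin.succ_ne_zero, if_false, Fin.val_succ]
      push_cast
      congr 1
      ring
    · intro j _ hj
      simp [Q, hj]
    · simp
  rw [← hQ, ← hPQ, hP]

/-- The expansion of `det [h_{f_i - m - 1 + j}]` along the row `p`. -/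
lemma detH_eq_sum_minorH (a : ℕ+ → A) (m : ℤ) {N : ℕ} (f : ℕ → ℤ) {p : ℕ} (hp : p ≤ N) :
    (-1) ^ p * detH a (m + 1) (N + 1) f = ∑ j : Fin (N + 1),
      (-1) ^ (j : ℕ) * completeHomog a (f p - m - 1 + (j : ℕ)) *
        minorH a m N (eraseSeq f p) j := by
  obtain ⟨p, rfl⟩ : ∃ p' : Fin (N + 1), p = p' := ⟨⟨p, Nat.lt_succ_of_le hp⟩, rfl⟩
  rw [detH, Matrix.det_succ_row _ p, Finset.mul_sum]
  refine Finset.sum_congr rfl fun j _ => ?_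
  rw [← mul_assoc, ← mul_assoc, pow_add, ← mul_assoc, ← pow_add, Even.neg_one_pow ⟨_, rfl⟩,
    one_mul, minorH, Matrix.of_apply, sub_sub]
  congr 2
  ext i k
  simp [eraseSeq_eq_succAbove, sub_sub]

/-- This is the expansion of a determinant in which the row of `f p` occurs twice; it removes the
terms where the element to be moved already lies in `f`. -/
lemma sum_minorH_eq_zero (a : ℕ+ → A) (m : ℤ) {N : ℕ} (f : ℕ → ℤ) {p : ℕ} (hp : p < N) :
    ∑ j : Fin (N + 1), (-1) ^ (j : ℕ) * completeHomog a (f p - m - 1 + (j : ℕ)) *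
        minorH a m N f j = 0 := by
  let P : Matrix (Fin (N + 1)) (Fin (N + 1)) A := Matrix.of fun i j =>
    Fin.cases (motive := fun _ => A) (completeHomog a (f p - m - 1 + (j : ℕ)))
      (fun i' : Fin N => completeHomog a (f i' - m - 1 + (j : ℕ))) i
  have hP : P.det = 0 := Matrix.det_zero_of_row_eq (i := 0) (j := (⟨p, hp⟩ : Fin N).succ)
    (Fin.succ_ne_zero _).symm (by ext j; simp [P])
  rw [← hP, Matrix.det_succ_row_zero]
  rfl

/-- `∑_q (-1)^q h_{g_q + e}(b + c) det(g without g_q) = ∑_r h_{r + e + l + 1}(c) colH_r`. -/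
lemma sum_completeHomog_mul_detH (b c : ℕ+ → A) (l : ℤ) (N : ℕ) (g : ℕ → ℤ) (e : ℤ)
    (he : e ≤ N - l - 1) (K : ℕ) (hK : ∀ q ≤ N, g q - (l + 1) < K) :
    ∑ q ∈ Finset.range (N + 1), (-1) ^ q * completeHomog (b + c) (g q + e) *
        detH b l N (eraseSeq g q) =
      ∑ r ∈ Finset.range K, completeHomog c (r + e + l + 1) * colH b l N g r := by
  -- The interval holds every y that contributes: h_{g_q + y}(b) vanishes for y < -l - K by the
  -- bound on `g`, and h_{e-y}(c) vanishes for y ≥ N - l by the bound on `e`.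
  have hcol : colDet b l N g (fun q => completeHomog (b + c) (g q + e)) =
      ∑ y ∈ Finset.Ico (-l - K) (N - l),
        completeHomog c (e - y) * colDet b l N g (fun q => completeHomog b (g q + y)) := by
    rw [← colDet_sum]
    refine colDet_congr b l N g fun q hq => completeHomog_add b c (g q) e _ fun y h1 h2 => ?_
    have := hK q hq
    rw [Finset.mem_Ico]
    omega
  rw [← colDet_eq_sum b l N g fun q => completeHomog (b + c) (g q + e), hcol]
  symm
  refine Finset.sum_of_injOn (fun r : ℕ => -(l + 1) - (r : ℤ)) ?_ ?_ ?_ ?_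
  · intro r _ r' _ h
    have h' : -(l + 1) - (r : ℤ) = -(l + 1) - r' := h
    omega
  · intro r hr
    have hr' : r < K := by simpa using hr
    rw [Finset.mem_coe, Finset.mem_Ico]
    dsimp only
    omega
  · intro y hy hy'
    rw [Finset.mem_Ico] at hy
    -- Only y = -(l+1) - r with r ≥ 0 survives: for y ≥ -l the new column repeats column y + l of
    -- the `N` old ones.
    have hyl : -l ≤ y := by
      by_contra hlt
      refine hy' ⟨(-(l + 1) - y).toNat, ?_, ?_⟩
      · rw [Finset.mem_coe, Finset.mem_range]
        omega
      · dsimp only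
        omega
    have hz := colDet_eq_zero_of_repeated b l (N := N) g (y + l).toNat (by omega)
    rw [show (((y + l).toNat : ℕ) : ℤ) = y + l by omega] at hz
    rw [colDet_congr b l N g (v' := fun q => completeHomog b (g q - l + (y + l)))
      fun q _ => by congr 1; ring, hz, mul_zero]
  · intro r _
    rw [show e - (-(l + 1) - (r : ℤ)) = r + e + l + 1 by ring]
    congr 1
    exact colDet_congr b l N g fun q _ => by congr 1; ring

/-- The bilinear identity between the determinants of two sequences. -/
lemma sum_minorH_mul_detH (a b : ℕ+ → A) (m l : ℤ) (N M : ℕ) (f g : ℕ → ℤ)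
    (hM : N + l - m ≤ M) (K : ℕ) (hK : ∀ q ≤ M, g q - (l + 1) < K) :
    ∑ q ∈ Finset.range (M + 1), (-1) ^ q * (∑ j : Fin (N + 1), (-1) ^ (j : ℕ) *
        completeHomog a (g q - m - 1 + (j : ℕ)) * minorH a m N f j) *
          detH b l M (eraseSeq g q) =
      ∑ j : Fin (N + 1), ∑ r ∈ Finset.range K, (-1) ^ (j : ℕ) * minorH a m N f j *
        colH b l M g r * completeHomog (a - b) ((j : ℕ) + (r : ℕ) - (m - l)) := by
  simp only [Finset.mul_sum, Finset.sum_mul]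
  rw [Finset.sum_comm]
  refine Finset.sum_congr rfl fun j _ => ?_
  -- The column index satisfies j ≤ N, so the assumption on `M` gives the bound -m - 1 + j ≤ M - l -
  -- 1 required here.
  have h := sum_completeHomog_mul_detH b (a - b) l M g (-m - 1 + (j : ℕ))
    (by have := j.isLt; omega) K hK
  rw [add_sub_cancel] at h
  calc _ = (-1) ^ (j : ℕ) * minorH a m N f j * ∑ q ∈ Finset.range (M + 1), (-1) ^ q *
        completeHomog a (g q + (-m - 1 + (j : ℕ))) * detH b l M (eraseSeq g q) := by
        rw [Finset.mul_sum]
        refine Finset.sum_congr rfl fun q _ => ?_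
        rw [show g q + (-m - 1 + ((j : ℕ) : ℤ)) = g q - m - 1 + (j : ℕ) by ring]
        ring
    _ = _ := by
        rw [h, Finset.mul_sum]
        refine Finset.sum_congr rfl fun r _ => ?_
        rw [show (r : ℤ) + (-m - 1 + (j : ℕ)) + l + 1 = (j : ℕ) + (r : ℕ) - (m - l) by ring]
        ring

/-- Rows beyond the tail of the sequence do not change the determinant. -/
lemma detH_succ (t : ℕ+ → A) (m : ℤ) (N : ℕ) (f : ℕ → ℤ) (hf : f N = m - N) :
    detH t m (N + 1) f = detH t m N f := by
  rw [detH, Matrix.det_succ_row _ (Fin.last N), Finset.sum_eq_single (Fin.last N)]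
  · rw [Matrix.of_apply, Fin.val_last, hf, show m - (N : ℤ) - m + N = 0 by ring,
      completeHomog_zero_index, mul_one, Even.neg_one_pow ⟨_, rfl⟩, one_mul, detH]
    congr 1
    ext i j
    simp
  · intro j _ hj
    have hj' : (j : ℕ) < N := Fin.val_lt_last hj
    rw [Matrix.of_apply, Fin.val_last, hf, completeHomog_of_neg _ (by omega), mul_zero, zero_mul]
  · simp

lemma detH_eq_of_le (t : ℕ+ → A) (m : ℤ) {N : ℕ} {f : ℕ → ℤ} (hf : ∀ i, N ≤ i → f i = m - i)
    {M : ℕ} (hM : N ≤ M) : detH t m M f = detH t m N f := by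
  induction M, hM using Nat.le_induction with
  | base => rfl
  | succ M hM ih => rw [detH_succ t m M f (hf M hM), ih]

end Determinants

/-! ### Charged sequences, insertion and deletion, and the bijection with partitions. -/

/-- Half-infinite strictly decreasing sequences of integers with `f_i = m - i` for large `i`. -/
def Maya (m : ℤ) : Type :=
  {f : ℕ → ℤ // StrictAnti f ∧ ∃ N : ℕ, ∀ i, N ≤ i → f i = m - i}

namespace Maya

variable {m : ℤ}

lemma ext_range {f g : Maya m} (h : Set.range f.1 = Set.range g.1) : f = g :=
  Subtype.ext ((StrictMono.range_inj (γ := ℤᵒᵈ) f.2.1.dual_right g.2.1.dual_right).mp h)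

lemma strictAnti_eraseSeq {f : ℕ → ℤ} (hf : StrictAnti f) (p : ℕ) : StrictAnti (eraseSeq f p) := by
  refine strictAnti_nat_of_succ_lt fun i => ?_
  unfold eraseSeq
  split_ifs <;> first | omega | exact hf (by omega)

lemma range_eraseSeq {f : ℕ → ℤ} (hf : StrictAnti f) (p : ℕ) :
    Set.range (eraseSeq f p) = Set.range f \ {f p} := by
  ext x
  constructor
  · rintro ⟨i, rfl⟩
    unfold eraseSeq
    split_ifs with h
    · exact ⟨⟨i, rfl⟩, fun h' => absurd (hf.injective h') (by omega)⟩
    · exact ⟨⟨i + 1, rfl⟩, fun h' => absurd (hf.injective h') (by omega)⟩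
  · rintro ⟨⟨i, rfl⟩, hi⟩
    have hip : i ≠ p := fun h => hi (congrArg f h)
    rcases lt_or_gt_of_ne hip with h | h
    · exact ⟨i, by rw [eraseSeq, if_pos h]⟩
    · refine ⟨i - 1, ?_⟩
      rw [eraseSeq, if_neg (by omega), Nat.sub_add_cancel (by omega)]

/-- The sequence without its `p`-th term. -/
def erase (f : Maya (m + 1)) (p : ℕ) : Maya m :=
  ⟨eraseSeq f.1 p, strictAnti_eraseSeq f.2.1 p, by
    obtain ⟨N, hN⟩ := f.2.2
    refine ⟨max N (p + 1), fun i hi => ?_⟩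
    rw [eraseSeq, if_neg (by omega), hN _ (by omega)]
    push_cast
    ring⟩

lemma range_erase (f : Maya (m + 1)) (p : ℕ) :
    Set.range (f.erase p).1 = Set.range f.1 \ {f.1 p} :=
  range_eraseSeq f.2.1 p

/-- Putting the deleted element back recovers the underlying set, and a decreasing sequence is
determined by its set of values. -/
lemma erase_injective {f f' : Maya (m + 1)} {p p' : ℕ} (h : f.erase p = f'.erase p')
    (hk : f.1 p = f'.1 p') : f = f' ∧ p = p' := by
  have hf : f = f' := by
    refine ext_range ?_
    have h1 := range_erase f p
    rw [h, range_erase f' p', hk] at h1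
    have h2 : ∀ S : Set ℤ, f.1 p ∈ S → insert (f.1 p) (S \ {f.1 p}) = S := fun S hS => by
      rw [Set.insert_sdiff_singleton, Set.insert_eq_of_mem hS]
    rw [← h2 (Set.range f.1) ⟨p, rfl⟩, ← h2 (Set.range f'.1) (hk ▸ ⟨p', rfl⟩), hk, h1]
  refine ⟨hf, ?_⟩
  subst hf
  exact f.2.1.injective hk

lemma exists_erase_eq (f : Maya m) {k : ℤ} (hk : k ∉ Set.range f.1) :
    ∃ (f' : Maya (m + 1)) (p : ℕ), f'.erase p = f ∧ f'.1 p = k := by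
  classical
  obtain ⟨N, hN⟩ := f.2.2
  -- The new element goes just before the first smaller term; one exists because the tail tends to
  -- -∞.
  have hex : ∃ i, f.1 i < k := by
    refine ⟨max N (m - k + 1).toNat, ?_⟩
    rw [hN _ (le_max_left _ _)]
    have := le_max_right N (m - k + 1).toNat
    omega
  let p := Nat.find hex
  have hp : f.1 p < k := Nat.find_spec hex
  have hlt : ∀ i, i < p → k < f.1 i := fun i hi =>
    lt_of_le_of_ne (not_lt.mp (Nat.find_min hex hi)) fun h => hk ⟨i, h.symm⟩
  let F : ℕ → ℤ := fun i => if i < p then f.1 i else if i = p then k else f.1 (i - 1)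
  have hFp : F p = k := by simp [F]
  have hF : StrictAnti F := by
    refine strictAnti_nat_of_succ_lt fun i => ?_
    simp only [F]
    rcases lt_trichotomy (i + 1) p with h | h | h
    · rw [if_pos h, if_pos (by omega)]
      exact f.2.1 (by omega)
    · rw [if_neg (by omega), if_pos h, if_pos (by omega)]
      exact hlt i (by omega)
    · rw [if_neg (by omega), if_neg (by omega), if_neg (by omega)]
      split_ifs with h2
      · exact lt_of_le_of_lt (f.2.1.antitone (by omega)) hp
      · exact f.2.1 (by omega)
  refine ⟨⟨F, hF, max N p + 1, fun i hi => ?_⟩, p, Subtype.ext (funext fun i => ?_), hFp⟩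
  · simp only [F]
    rw [if_neg (by omega), if_neg (by omega), hN _ (by omega)]
    omega
  · change eraseSeq F p i = f.1 i
    simp only [eraseSeq, F]
    split_ifs <;> first | rfl | omega

/-- If the deleted position were beyond `N`, its two neighbours would be consecutive integers,
leaving no room for the deleted term. Thus one explicit size `N + 1` serves all enlarged sequences.
-/
lemma le_of_erase_eq {f : Maya m} {f' : Maya (m + 1)} {p : ℕ} (h : f'.erase p = f) {N : ℕ}
    (hN : ∀ i, N ≤ i → f.1 i = m - i) : p ≤ N ∧ ∀ i, N + 1 ≤ i → f'.1 i = m + 1 - i := by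
  subst h
  have hp : p ≤ N := by
    by_contra hlt
    have h1 := hN N le_rfl
    have h2 := hN p (by omega)
    obtain ⟨M, hM⟩ := f'.2.2
    have h3 := hM (M + p + N) (by omega)
    have h4 : ∀ j : ℕ, f'.1 (p + 1 + j) = m - (p : ℤ) - j := by
      intro j
      have := hN (p + j) (by omega)
      change eraseSeq f'.1 p (p + j) = _ at this
      rw [eraseSeq, if_neg (by omega)] at this
      rw [show p + 1 + j = p + j + 1 by omega, this]
      push_cast
      ring
    have h5 := hN (p - 1) (by omega)
    change eraseSeq f'.1 p (p - 1) = _ at h5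
    rw [eraseSeq, if_pos (by omega)] at h5
    have h6 := f'.2.1 (show p - 1 < p by omega)
    have h7 := f'.2.1 (show p < p + 1 + 0 by omega)
    have h8 := h4 0
    omega
  refine ⟨hp, fun i hi => ?_⟩
  have := hN (i - 1) (by omega)
  change eraseSeq f'.1 p (i - 1) = _ at this
  rw [eraseSeq, if_neg (by omega), Nat.sub_add_cancel (by omega)] at this
  rw [this]
  omega

/-- The sequence `μ_i - i + m`. -/
def ofDiagram (m : ℤ) (μ : YoungDiagram) : Maya m :=
  ⟨fun i => μ.rowLen i - i + m, by
    refine strictAnti_nat_of_succ_lt fun i => ?_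
    have := μ.rowLen_anti i (i + 1) (by omega)
    push_cast
    omega,
   ⟨μ.colLen 0, fun i hi => by
    have h : μ.rowLen i = 0 := by
      by_contra h0
      have h1 := YoungDiagram.mem_iff_lt_colLen.mp
        (YoungDiagram.mem_iff_lt_rowLen.mpr (Nat.pos_of_ne_zero h0))
      omega
    dsimp only
    rw [h]
    push_cast
    ring⟩⟩

lemma ofDiagram_injective (m : ℤ) : Function.Injective (ofDiagram m) := by
  intro μ ν h
  have h1 : ∀ i, μ.rowLen i = ν.rowLen i := by
    intro i
    have : (μ.rowLen i : ℤ) - i + m = ν.rowLen i - i + m :=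
      congrFun (congrArg Subtype.val h) i
    omega
  refine YoungDiagram.ext (Finset.ext fun ⟨i, j⟩ => ?_)
  rw [YoungDiagram.mem_cells, YoungDiagram.mem_cells, YoungDiagram.mem_iff_lt_rowLen,
    YoungDiagram.mem_iff_lt_rowLen, h1]

lemma ofDiagram_surjective (m : ℤ) : Function.Surjective (ofDiagram m) := by
  intro f
  obtain ⟨N, hN⟩ := f.2.2
  -- The row lengths are recovered as f_i + i - m: these are weakly decreasing because f drops by at
  -- least 1 each time, and they are eventually 0.
  have hanti : Antitone fun i : ℕ => f.1 i + i - m := by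
    refine antitone_nat_of_succ_le fun i => ?_
    have := f.2.1 (Nat.lt_succ_self i)
    push_cast
    simp only [Nat.succ_eq_add_one] at this
    omega
  have hnonneg : ∀ i : ℕ, 0 ≤ f.1 i + i - m := by
    intro i
    have h1 := hanti (le_max_left i N)
    have h2 := hN _ (le_max_right i N)
    dsimp only at h1
    omega
  let μ : YoungDiagram :=
    ⟨(Finset.range N).biUnion fun i => {i} ×ˢ Finset.range (f.1 i + i - m).toNat, by
      rintro ⟨i, j⟩ ⟨i', j'⟩ ⟨hi, hj⟩ hc
      simp only [Finset.coe_biUnion, Set.mem_iUnion, Finset.mem_coe, Finset.mem_product,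
        Finset.mem_singleton, Finset.mem_range] at hc ⊢
      obtain ⟨_, h1, rfl, h2⟩ := hc
      have h3 := hanti (show i' ≤ i from hi)
      dsimp only at h3 hi hj
      exact ⟨i', by omega, rfl, by omega⟩⟩
  have hμ : ∀ i j, (i, j) ∈ μ ↔ j < (f.1 i + i - m).toNat := by
    intro i j
    rw [← YoungDiagram.mem_cells]
    simp only [μ, Finset.mem_biUnion, Finset.mem_product, Finset.mem_singleton, Finset.mem_range]
    constructor
    · rintro ⟨_, _, rfl, h⟩
      exact h
    · intro h
      refine ⟨i, ?_, rfl, h⟩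
      by_contra hi
      have := hN i (by omega)
      omega
  refine ⟨μ, Subtype.ext (funext fun i => ?_)⟩
  have hrow : μ.rowLen i = (f.1 i + i - m).toNat := by
    refine eq_of_forall_lt_iff fun j => ?_
    rw [← YoungDiagram.mem_iff_lt_rowLen, hμ]
  change (μ.rowLen i : ℤ) - i + m = f.1 i
  rw [hrow]
  have := hnonneg i
  omega

/-- Partitions correspond to sequences of any given charge `m`. -/
noncomputable def equivDiagram (m : ℤ) : YoungDiagram ≃ Maya m :=
  Equiv.ofBijective (ofDiagram m) ⟨ofDiagram_injective m, ofDiagram_surjective m⟩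

/-- The partition of a sequence. -/
noncomputable def diagram (f : Maya m) : YoungDiagram := (equivDiagram m).symm f

lemma ofDiagram_diagram (f : Maya m) : ofDiagram m f.diagram = f :=
  (equivDiagram m).apply_symm_apply f

section Schur

variable {A : Type*} [CommRing A] [Algebra ℚ A]

/-- The Schur function of a sequence. -/
noncomputable def schurFun (t : ℕ+ → A) (f : Maya m) : A := schur t f.diagram

/-- The true tail starts at the length of the partition, and enlarging the determinant past it
changes nothing. This allows one common size for several sequences. -/
lemma schurFun_eq_detH (t : ℕ+ → A) (f : Maya m) {N : ℕ} (hN : ∀ i, N ≤ i → f.1 i = m - i) :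
    schurFun t f = detH t m N f.1 := by
  have hf : ∀ i, f.1 i = f.diagram.rowLen i - i + m := fun i =>
    (congrFun (congrArg Subtype.val (ofDiagram_diagram f)) i).symm
  have hrow : ∀ i, f.diagram.colLen 0 ≤ i ↔ f.1 i = m - i := by
    intro i
    rw [hf, ← not_lt, ← YoungDiagram.mem_iff_lt_colLen, YoungDiagram.mem_iff_lt_rowLen]
    omega
  have hle : f.diagram.colLen 0 ≤ N := (hrow N).mpr (hN N le_rfl)
  rw [detH_eq_of_le t m (fun i hi => (hrow i).mp hi) hle, schurFun, schur, detH]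
  congr 1
  ext i j
  rw [Matrix.of_apply, Matrix.of_apply, hf]
  congr 1
  ring

end Schur

end Maya

/-! ### Transfers of an element between two sequences. -/

/-- The ways to move a common element from `g` to `f`, in terms of the larger sequences. -/
def Transfer (m l : ℤ) : Type :=
  {x : (Maya (m + 1) × ℕ) × (Maya (l + 1) × ℕ) // x.1.1.1 x.1.2 = x.2.1.1 x.2.2}

namespace Transfer

variable {m l : ℤ}

/-- The pair with the common element in the second sequence only. -/
def source (x : Transfer m l) : Maya m × Maya (l + 1) := (x.1.1.1.erase x.1.1.2, x.1.2.1)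

/-- The pair with the common element in the first sequence only. -/
def target (x : Transfer m l) : Maya (m + 1) × Maya l := (x.1.1.1, x.1.2.1.erase x.1.2.2)

/-- The sign of a transfer. -/
def sign (R : Type*) [CommRing R] (x : Transfer m l) : R := (-1) ^ x.1.1.2 * (-1) ^ x.1.2.2

/-- The inverse transfers. -/
def swap (m l : ℤ) : Transfer m l ≃ Transfer l m where
  toFun x := ⟨x.1.swap, x.2.symm⟩
  invFun x := ⟨x.1.swap, x.2.symm⟩
  left_inv _ := rfl
  right_inv _ := rfl

lemma source_swap (x : Transfer m l) : source (swap m l x) = x.target.swap := rfl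

lemma target_swap (x : Transfer m l) : target (swap m l x) = x.source.swap := rfl

lemma sign_swap (R : Type*) [CommRing R] (x : Transfer m l) :
    sign R (swap m l x) = sign R x := mul_comm _ _

/-- The position of the common element in the second sequence determines a transfer. -/
lemma eq_of_source_eq {x y : Transfer m l} (h : x.source = y.source) (hq : x.1.2.2 = y.1.2.2) :
    x = y := by
  have h1 : x.1.1.1.erase x.1.1.2 = y.1.1.1.erase y.1.1.2 := congrArg Prod.fst h
  have h2 : x.1.2.1 = y.1.2.1 := congrArg Prod.snd h
  have h3 := Maya.erase_injective h1 (by rw [x.2, y.2, h2, hq])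
  exact Subtype.ext (Prod.ext (Prod.ext h3.1 h3.2) (Prod.ext h2 hq))

lemma exists_source_eq (f : Maya m) (g : Maya (l + 1)) {q : ℕ} (hq : g.1 q ∉ Set.range f.1) :
    ∃ x : Transfer m l, x.source = (f, g) ∧ x.1.2.2 = q := by
  obtain ⟨f', p, h1, h2⟩ := f.exists_erase_eq hq
  exact ⟨⟨((f', p), (g, q)), h2⟩, Prod.ext h1 rfl, rfl⟩

lemma not_mem_range (x : Transfer m l) : x.1.2.1.1 x.1.2.2 ∉ Set.range x.source.1.1 := by
  intro h
  rw [source, Maya.range_erase, ← x.2] at h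
  exact h.2 rfl

/-- Chooses a determinant size for `g` beyond which every term already belongs to `f` and so cannot
be transferred; the first bound is the one needed in `sum_minorH_mul_detH`. -/
lemma exists_bound (f : Maya m) (g : Maya (l + 1)) (N : ℕ) :
    ∃ M : ℕ, N + l - m ≤ M ∧ (∀ i, M ≤ i → g.1 i = l + 1 - i) ∧
      ∀ q, M < q → g.1 q ∈ Set.range f.1 := by
  obtain ⟨N', hN'⟩ := f.2.2
  obtain ⟨M', hM'⟩ := g.2.2
  -- Past its tail, g_q = l + 1 - q is the term of `f` at index m - g_q = m - l - 1 + q; the summand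
  -- (l - m)⁺ pushes this index past `N'`.
  refine ⟨max M' (N + N' + (l - m).toNat + (m - l).toNat), by omega, fun i hi => ?_, fun q hq => ?_⟩
  · exact hM' i (by omega)
  · refine ⟨(m - g.1 q).toNat, ?_⟩
    have h := hM' q (by omega)
    rw [hN' _ (by omega)]
    omega

/-- A transfer with given source is determined by the position of its element in the second
sequence, and that position is bounded by `exists_bound`. -/
instance finite_source (y : Maya m × Maya (l + 1)) : Finite {x : Transfer m l // x.source = y} := by
  obtain ⟨M, -, -, hM⟩ := exists_bound y.1 y.2 0
  refine Finite.of_injective (β := Fin (M + 1)) (fun x => ⟨x.1.1.2.2, ?_⟩) ?_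
  · by_contra hlt
    have h1 := not_mem_range x.1
    rw [x.2] at h1
    have h2 : x.1.1.2.1 = y.2 := congrArg Prod.snd x.2
    rw [h2] at h1
    exact h1 (hM _ (by omega))
  · intro x x' h
    exact Subtype.ext (eq_of_source_eq (x.2.trans x'.2.symm) (congrArg Fin.val h))

instance finite_target (y : Maya (m + 1) × Maya l) : Finite {x : Transfer m l // x.target = y} := by
  refine Finite.of_injective (β := {x : Transfer l m // x.source = y.swap})
    (fun x => ⟨swap m l x.1, by rw [source_swap, x.2]⟩) fun x x' h => ?_
  exact Subtype.ext ((swap m l).injective (congrArg Subtype.val h))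

variable {A : Type*} [CommRing A] [Algebra ℚ A]

/-- The bilinear identity of Schur functions. -/
lemma finsum_schurFun_mul (a b : ℕ+ → A) (f : Maya m) (g : Maya (l + 1)) (N : ℕ)
    (hN : ∀ i, N ≤ i → f.1 i = m - i) (M : ℕ) (hMN : N + l - m ≤ M)
    (hMg : ∀ i, M ≤ i → g.1 i = l + 1 - i) (hMf : ∀ q, M < q → g.1 q ∈ Set.range f.1)
    (K : ℕ) (hK : ∀ q ≤ M, g.1 q - (l + 1) < K) :
    ∑ᶠ x : {x : Transfer m l // x.source = (f, g)},
        sign A x.1 * (x.1.target.1.schurFun a * x.1.target.2.schurFun b) =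
      ∑ j : Fin (N + 1), ∑ r ∈ Finset.range K, (-1) ^ (j : ℕ) * minorH a m N f.1 j *
        colH b l M g.1 r * completeHomog (a - b) ((j : ℕ) + (r : ℕ) - (m - l)) := by
  rw [← sum_minorH_mul_detH a b m l N M f.1 g.1 hMN K hK]
  have := Fintype.ofFinite {x : Transfer m l // x.source = (f, g)}
  rw [finsum_eq_sum_of_fintype]
  have hg : ∀ x : {x : Transfer m l // x.source = (f, g)}, x.1.1.2.1 = g := fun x =>
    congrArg Prod.snd x.2
  have hf : ∀ x : {x : Transfer m l // x.source = (f, g)}, x.1.1.1.1.erase x.1.1.1.2 = f :=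
    fun x => congrArg Prod.fst x.2
  have hq : ∀ x : {x : Transfer m l // x.source = (f, g)}, x.1.1.2.2 ≤ M := by
    intro x
    by_contra hlt
    have h1 := not_mem_range x.1
    rw [x.2, hg] at h1
    exact h1 (hMf _ (by omega))
  refine Finset.sum_of_injOn (fun x => x.1.1.2.2) ?_ ?_ ?_ ?_
  · intro x _ y _ h
    exact Subtype.ext (eq_of_source_eq (x.2.trans y.2.symm) h)
  · intro x _
    exact Finset.mem_coe.mpr (Finset.mem_range.mpr (Nat.lt_succ_of_le (hq x)))
  · intro q _ hq'
    have hmem : g.1 q ∈ Set.range f.1 := by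
      by_contra hmem
      obtain ⟨x, hx, hxq⟩ := exists_source_eq f g hmem
      exact hq' ⟨⟨x, hx⟩, Finset.mem_coe.mpr (Finset.mem_univ _), hxq⟩
    obtain ⟨i, hi⟩ := hmem
    -- If g_q = f_i, no transfer exists. The row expansion vanishes by a repeated row when i < N,
    -- and when i ≥ N because all indices -i - 1 + j are negative.
    have hzero : ∑ j : Fin (N + 1), (-1) ^ (j : ℕ) *
        completeHomog a (g.1 q - m - 1 + (j : ℕ)) * minorH a m N f.1 j = 0 := by
      rw [← hi]
      rcases lt_or_ge i N with h | h
      · exact sum_minorH_eq_zero a m f.1 h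
      · refine Finset.sum_eq_zero fun j _ => ?_
        have := j.isLt
        rw [hN i h, completeHomog_of_neg a (by omega), mul_zero, zero_mul]
    rw [hzero, mul_zero, zero_mul]
  · intro x _
    have h1 := Maya.le_of_erase_eq (hf x) hN
    -- The sign (-1)^p absorbs the cofactor sign of the inserted row; (-1)^q comes from the
    -- expansion along the column of `g`.
    have h2 := detH_eq_sum_minorH a m x.1.1.1.1.1 h1.1
    have h3 : eraseSeq x.1.1.1.1.1 x.1.1.1.2 = f.1 := congrArg Subtype.val (hf x)
    rw [h3, x.1.2, hg] at h2
    have h4 := Maya.schurFun_eq_detH a x.1.1.1.1 (N := N + 1) h1.2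
    have h5 : x.1.target.2.schurFun b = detH b l M (eraseSeq g.1 x.1.1.2.2) := by
      have h6 : x.1.target.2 = g.erase x.1.1.2.2 := by
        change x.1.1.2.1.erase _ = _
        rw [hg]
      rw [h6, Maya.schurFun_eq_detH b _ (N := M)]
      · rfl
      · intro i hi
        change eraseSeq _ _ i = _
        have := hq x
        rw [eraseSeq, if_neg (by omega), hMg _ (by omega)]
        push_cast
        ring
    rw [h5, ← h2, ← h4, sign]
    change _ * (x.1.1.1.1.schurFun a * _) = _
    ring

end Transfer

/-! ### Compatibility with ring homomorphisms, for adjoining z and passing to dual numbers. -/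

section Naturality

variable {A B F : Type*} [CommRing A] [Algebra ℚ A] [CommRing B] [Algebra ℚ B] [FunLike F A B]
  [RingHomClass F A B] (φ : F)

lemma map_minorH (t : ℕ+ → A) (m : ℤ) (N : ℕ) (f : ℕ → ℤ) (j : Fin (N + 1)) :
    φ (minorH t m N f j) = minorH (fun k => φ (t k)) m N f j := by
  refine ((φ : A →+* B).map_det _).trans ?_
  rw [minorH]
  congr 1
  ext i j
  exact map_completeHomog (φ : A →+* B) t _

lemma map_detH (t : ℕ+ → A) (m : ℤ) (N : ℕ) (f : ℕ → ℤ) :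
    φ (detH t m N f) = detH (fun k => φ (t k)) m N f := by
  refine ((φ : A →+* B).map_det _).trans ?_
  rw [detH]
  congr 1
  ext i j
  exact map_completeHomog (φ : A →+* B) t _

lemma map_colH (t : ℕ+ → A) (l : ℤ) (N : ℕ) (g : ℕ → ℤ) (r : ℕ) :
    φ (colH t l N g r) = colH (fun k => φ (t k)) l N g r := by
  have h : ∀ n, φ (completeHomog t n) = completeHomog (fun k => φ (t k)) n :=
    map_completeHomog (φ : A →+* B) t
  simp only [colH, colDet_eq_sum, map_sum, map_mul, map_pow, map_neg, map_one, map_detH, h]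

lemma map_schurFun {m : ℤ} (t : ℕ+ → A) (f : Maya m) :
    φ (f.schurFun t) = f.schurFun fun k => φ (t k) :=
  map_schur (φ : A →+* B) t _

end Naturality

/-! ### The τ-functions as convergent sums over charged sequences. -/

section Topology

/-- The coefficientwise sum is the sum for the topology of coefficientwise convergence. -/
lemma FormallySummable.hasSum {σ K ι : Type*} [CommRing K] [TopologicalSpace K]
    {f : ι → MvPowerSeries σ K} (hf : FormallySummable f) :
    HasSum f (formalSum f) := by
  rw [WithPiTopology.hasSum_iff_hasSum_coeff]
  intro d
  have h : coeff d (formalSum f) = ∑ i ∈ (hf d).toFinset, coeff d (f i) := by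
    change ∑ᶠ i, coeff d (f i) = _
    exact finsum_eq_sum_of_support_subset _ (by rw [Set.Finite.coe_toFinset]; exact subset_rfl)
  rw [h]
  exact hasSum_sum_of_ne_finset_zero fun i hi => by
    by_contra h0
    exact hi ((hf d).mem_toFinset.mpr h0)

/-- The indicator of the sequences that contain all elements of `X`. -/
noncomputable def indicator (R : Type*) [CommRing R] (X : Set ℚ) (S : Set ℤ) : R :=
  open Classical in if X ⊆ (fun k : ℤ => (k : ℚ) - 1 / 2) '' S then 1 else 0

lemma map_indicator {R S F : Type*} [CommRing R] [CommRing S] [FunLike F R S]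
    [RingHomClass F R S] (φ : F) (X : Set ℚ) (T : Set ℤ) : φ (indicator R X T) = indicator S X T := by
  unfold indicator
  split_ifs <;> simp

/-- Translating X by -n is the same as raising the charge to n. The shift 1/2 changes sign because
rows are counted from 0 in the sequence. -/
lemma translate_subset_iff (X : Set ℚ) (n : ℤ) (μ : YoungDiagram) :
    translate X n ⊆ modifiedSet μ ↔
      X ⊆ (fun k : ℤ => (k : ℚ) - 1 / 2) '' Set.range (Maya.ofDiagram n μ).1 := by
  rw [translate, Set.image_subset_iff]
  refine forall₂_congr fun x _ => ?_
  rw [← Set.range_comp]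
  refine exists_congr fun i => ?_
  simp only [Maya.ofDiagram, Function.comp_apply]
  push_cast
  constructor <;> intro h <;> linarith

/-- Substitution of sequences with `deg a_k = deg b_k = k` is possible. -/
lemma hasSubst_of_mem_homog {K τ : Type*} [Field K] [CharZero K]
    {w : τ → ℕ} {a : Time → MvPowerSeries τ K}
    (h : ∀ k : ℕ+, a (.t k) ∈ homog K w k) (h' : ∀ k : ℕ+, a (.t' k) ∈ homog K w k) :
    MvPowerSeries.HasSubst a := by
  have hd : ∀ i d, coeff d (a i) ≠ 0 → ∃ k : ℕ+, (k : ℕ) = Finsupp.weight w d ∧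
      (i = .t k ∨ i = .t' k) := by
    intro i d hd
    rcases i with k | k
    · exact ⟨k, (h k d hd).symm, Or.inl rfl⟩
    · exact ⟨k, (h' k d hd).symm, Or.inr rfl⟩
  refine ⟨fun i => ?_, fun d => ?_⟩
  · have h0 : constantCoeff (a i) = 0 := by
      by_contra h0
      rw [← coeff_zero_eq_constantCoeff_apply] at h0
      obtain ⟨k, hk, -⟩ := hd i 0 h0
      rw [map_zero] at hk
      exact k.ne_zero hk
    rw [h0]
    exact IsNilpotent.zero
  · by_cases hw : 0 < Finsupp.weight w d
    · refine (Set.toFinite {Time.t ⟨_, hw⟩, Time.t' ⟨_, hw⟩}).subset fun i hi => ?_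
      obtain ⟨k, hk, hik⟩ := hd i d hi
      obtain rfl : k = ⟨_, hw⟩ := PNat.eq hk
      exact hik
    · convert Set.finite_empty
      refine Set.eq_empty_of_forall_notMem fun i hi => ?_
      obtain ⟨k, hk, -⟩ := hd i d hi
      exact hw (hk ▸ k.pos)

variable {σ K : Type*} [Field K] [UniformSpace K] [DiscreteUniformity K]

/-- Over a discrete field, this lets convergent sums be multiplied into sums over pairs without any
absolute convergence. -/
lemma nonarchimedeanRing_mvPowerSeries : NonarchimedeanRing (MvPowerSeries σ K) where
  is_nonarchimedean U hU := by
    obtain ⟨I, hI, hIU⟩ := (IsLinearTopology.hasBasis_ideal (R := MvPowerSeries σ K)).mem_iff.mp hU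
    exact ⟨⟨I.toAddSubgroup, AddSubgroup.isOpen_of_mem_nhds I.toAddSubgroup hI⟩, hIU⟩

variable [CharZero K]

lemma hasSum_correlationTau (X : Set ℚ) (n : ℤ) :
    HasSum (fun f : Maya n => indicator _ X (Set.range f.1) *
      (f.schurFun (fun k => MvPowerSeries.X (Time.t k)) *
        f.schurFun (fun k => MvPowerSeries.X (Time.t' k)))) (correlationTau K X n) := by
  classical
  have h1 := ((formallySummable_schurMeasure K
    (fun μ => translate X n ⊆ modifiedSet μ)).hasSum).mul_left (schurZ K)
  have h2 : ∀ μ : YoungDiagram, schurZ K * schurMeasure K μ = schurWeight K μ := fun μ => by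
    rw [schurMeasure, ← mul_assoc, MvPowerSeries.mul_inv_cancel _ (by
      rw [constantCoeff_schurZ]; exact one_ne_zero), one_mul]
  simp only [h2] at h1
  have h3 := (hasSum_subtype_iff_indicator (f := schurWeight K)
    (s := {μ | translate X n ⊆ modifiedSet μ})).mp h1
  rw [← (Maya.equivDiagram n).symm.hasSum_iff] at h3
  change HasSum _ (schurZ K * formalSum _)
  convert h3 using 2 with f
  have h4 := translate_subset_iff X n f.diagram
  rw [Maya.ofDiagram_diagram] at h4
  rw [indicator, Function.comp_apply]
  by_cases h : translate X n ⊆ modifiedSet f.diagram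
  · rw [if_pos (h4.mp h), one_mul, Set.indicator_of_mem h]
    rfl
  · rw [if_neg (fun h' => h (h4.mpr h')), zero_mul, Set.indicator_of_notMem h]

/-- Substitution is a continuous algebra homomorphism, so it acts termwise; homogeneity of the two
sequences makes the substitution legitimate. -/
lemma hasSum_evalAt_correlationTau {τ : Type*} {w : τ → ℕ} {a b : ℕ+ → MvPowerSeries τ K}
    (ha : ∀ k : ℕ+, a k ∈ homog K w k) (hb : ∀ k : ℕ+, b k ∈ homog K w k) (X : Set ℚ) (n : ℤ) :
    HasSum (fun f : Maya n => indicator _ X (Set.range f.1) * (f.schurFun a * f.schurFun b))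
      (evalAt (correlationTau K X n) a b) := by
  let c : Time → MvPowerSeries τ K := fun i : Time => match i with
    | .t k => a k
    | .t' k => b k
  have hc : MvPowerSeries.HasSubst c := hasSubst_of_mem_homog ha hb
  have h1 := (hasSum_correlationTau X n (K := K)).map (substAlgHom hc)
    (by rw [coe_substAlgHom]; exact continuous_subst hc)
  convert h1 using 1
  · funext f
    rw [Function.comp_apply, map_mul, map_mul]
    have h2 : ∀ t : ℕ+ → MvPowerSeries Time K, substAlgHom (R := K) hc (f.schurFun t) =
        f.schurFun fun k => substAlgHom (R := K) hc (t k) :=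
      fun t => map_schurFun _ t f
    have h3 : substAlgHom (R := K) hc (indicator _ X (Set.range f.1)) =
        indicator _ X (Set.range f.1) :=
      map_indicator _ X _
    rw [h2, h2, h3]
    simp only [substAlgHom_X]
    rfl
  · rw [coe_substAlgHom]
    rfl

end Topology

/-! ### Extraction of the coefficient of z with the factor γ(1/z, a). -/

section ZCoeff

variable {σ K : Type*} [Field K]

lemma coeff_zCoeff (F : MvPowerSeries (Option σ) K) (n : ℤ) (d : σ →₀ ℕ) :
    coeff d (zCoeff F n) = if 0 ≤ n then coeff (Finsupp.optionElim n.toNat d) F else 0 := by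
  by_cases h : 0 ≤ n
  · have hz : zCoeff F n = fun d => coeff (Finsupp.optionElim n.toNat d) F := if_pos h
    rw [hz, if_pos h]
    rfl
  · have hz : zCoeff F n = 0 := if_neg h
    rw [hz, if_neg h, map_zero]

instance tendstoCofinite_some : Filter.TendstoCofinite (some : σ → Option σ) :=
  ⟨(Option.some_injective σ).tendsto_cofinite⟩

lemma zCoeff_X_pow_mul_rename (p : ℕ) (u : MvPowerSeries σ K) (n : ℤ) :
    zCoeff (X none ^ p * rename some u) n = if n = p then u else 0 := by
  classical
  ext d
  rw [coeff_zCoeff, X_pow_eq, coeff_monomial_mul, one_mul]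
  by_cases hn : 0 ≤ n
  · obtain ⟨n, rfl⟩ := Int.eq_ofNat_of_zero_le hn
    rw [if_pos hn, Int.toNat_natCast]
    have hle : Finsupp.single none p ≤ Finsupp.optionElim n d ↔ p ≤ n := by
      rw [Finsupp.single_le_iff, Finsupp.optionElim_apply_none]
    by_cases hpn : p ≤ n
    · rw [if_pos (hle.mpr hpn)]
      have hsub : Finsupp.optionElim n d - Finsupp.single none p =
          Finsupp.optionElim (n - p) d := by
        ext i
        rcases i with _ | i
        · simp
        · simp
      rw [hsub]
      by_cases hnp : n = p
      · subst hnp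
        rw [if_pos rfl, Nat.sub_self]
        have : Finsupp.optionElim 0 d = Finsupp.embDomain Function.Embedding.some d := by
          ext i
          rcases i with _ | i
          · rw [Finsupp.optionElim_apply_none, Finsupp.embDomain_of_notMem_range _ _ _ (by simp)]
          · rw [Finsupp.optionElim_apply_some]
            exact (Finsupp.embDomain_apply_self Function.Embedding.some d i).symm
        rw [this]
        exact coeff_embDomain_rename Function.Embedding.some u d
      · rw [if_neg (by omega), map_zero]
        refine coeff_rename_eq_zero some u ?_
        rintro ⟨e, he⟩
        have h0 := DFunLike.congr_fun he none
        rw [Finsupp.optionElim_apply_none, Finsupp.mapDomain_of_notMem_range _ _ (by simp)] at h0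
        omega
    · rw [if_neg (fun h => hpn (hle.mp h)), if_neg (by omega), map_zero]
  · rw [if_neg hn, if_neg (by omega), map_zero]

variable [CharZero K] {w : σ → ℕ} {a : ℕ+ → MvPowerSeries σ K}

lemma coeff_completeHomog_mul_eq_zero (ha : ∀ k : ℕ+, a k ∈ homog K w k) (u : MvPowerSeries σ K)
    {d : σ →₀ ℕ} {n : ℤ} (hn : Finsupp.weight w d < n) : coeff d (completeHomog a n * u) = 0 := by
  by_contra h
  rw [mul_comm] at h
  have := le_weight_of_coeff_mul_ne_zero (completeHomog_mem_homog a ha n) h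
  omega

/-- The degree of h_j(a) bounds the relevant j at each monomial. This finite formula gives
additivity and continuity of the extraction, hence its termwise application to infinite sums. -/
lemma coeff_gammaInvMulCoeff (ha : ∀ k : ℕ+, a k ∈ homog K w k) (n : ℤ)
    (F : MvPowerSeries (Option σ) K) (d : σ →₀ ℕ) :
    coeff d (gammaInvMulCoeff n a F) = ∑ j ∈ Finset.range (Finsupp.weight w d + 1),
      coeff d (completeHomog a j * zCoeff F (n + j)) := by
  classical
  change ∑ᶠ j, coeff d (gammaInvMulTerm n a F j) = _
  rw [finsum_eq_sum_of_support_subset (s := (Finset.range (Finsupp.weight w d + 1)).image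
    fun j : ℕ => -(j : ℤ)), Finset.sum_image]
  · refine Finset.sum_congr rfl fun j _ => ?_
    rw [gammaInvMulTerm, neg_neg, sub_neg_eq_add]
  · intro i _ j _ h
    simpa using h
  · intro j hj
    rw [Function.mem_support, gammaInvMulTerm] at hj
    rw [Finset.mem_coe, Finset.mem_image]
    refine ⟨(-j).toNat, ?_, ?_⟩
    · rw [Finset.mem_range]
      by_contra h
      exact hj (coeff_completeHomog_mul_eq_zero ha _ (by omega))
    · by_contra h
      rw [completeHomog_of_neg a (by omega), zero_mul, map_zero] at hj
      exact hj rfl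

/-- `F ↦ [z^n] (γ(1/z, a) F(z))` as a homomorphism. -/
noncomputable def gammaInvMulHom (ha : ∀ k : ℕ+, a k ∈ homog K w k) (n : ℤ) :
    MvPowerSeries (Option σ) K →+ MvPowerSeries σ K :=
  AddMonoidHom.mk' (gammaInvMulCoeff n a) fun F G => by
    ext d
    rw [map_add, coeff_gammaInvMulCoeff ha, coeff_gammaInvMulCoeff ha, coeff_gammaInvMulCoeff ha,
      ← Finset.sum_add_distrib]
    refine Finset.sum_congr rfl fun j _ => ?_
    have : zCoeff (F + G) (n + j) = zCoeff F (n + j) + zCoeff G (n + j) := by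
      ext e
      rw [map_add, coeff_zCoeff, coeff_zCoeff, coeff_zCoeff]
      split_ifs <;> simp
    rw [this, mul_add, map_add]

lemma continuous_gammaInvMulHom [UniformSpace K] [DiscreteUniformity K]
    (ha : ∀ k : ℕ+, a k ∈ homog K w k) (n : ℤ) : Continuous (gammaInvMulHom ha n) := by
  refine continuous_pi fun d => ?_
  have h : (fun F => gammaInvMulHom ha n F d) =
      fun F => ∑ j ∈ Finset.range (Finsupp.weight w d + 1),
        coeff d (completeHomog a j * zCoeff F (n + j)) :=
    funext fun F => coeff_gammaInvMulCoeff ha n F d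
  rw [h]
  refine continuous_finsetSum _ fun j _ => (WithPiTopology.continuous_coeff K d).comp
    (continuous_const.mul (continuous_pi fun e => ?_))
  have h2 : (fun F => zCoeff F (n + j) e) = fun F : MvPowerSeries (Option σ) K =>
      if 0 ≤ n + (j : ℤ) then coeff (Finsupp.optionElim (n + (j : ℤ)).toNat e) F else 0 :=
    funext fun F => coeff_zCoeff F (n + j) e
  rw [h2]
  split_ifs
  · exact WithPiTopology.continuous_coeff K _
  · exact continuous_const

/-- Against z^p only the power z^{-(p-n)} of γ(1/z, a) contributes to z^n, and its coefficient is
h_{p-n}(a). -/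
lemma gammaInvMulHom_X_pow_mul_rename (ha : ∀ k : ℕ+, a k ∈ homog K w k) (n : ℤ) (p : ℕ)
    (u : MvPowerSeries σ K) :
    gammaInvMulHom ha n (X none ^ p * rename some u) = completeHomog a (p - n) * u := by
  ext d
  change coeff d (gammaInvMulCoeff n a _) = _
  rw [coeff_gammaInvMulCoeff ha]
  simp only [zCoeff_X_pow_mul_rename]
  by_cases h0 : (p : ℤ) - n < 0
  · rw [completeHomog_of_neg a h0, zero_mul, map_zero]
    refine Finset.sum_eq_zero fun j _ => ?_
    rw [if_neg (by omega), mul_zero, map_zero]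
  · by_cases h1 : (Finsupp.weight w d : ℤ) < p - n
    · rw [coeff_completeHomog_mul_eq_zero ha u h1]
      refine Finset.sum_eq_zero fun j hj => ?_
      rw [Finset.mem_range] at hj
      rw [if_neg (by omega), mul_zero, map_zero]
    · rw [Finset.sum_eq_single ((p : ℤ) - n).toNat]
      · rw [if_pos (by omega), show ((((p : ℤ) - n).toNat : ℕ) : ℤ) = p - n by omega]
      · intro j _ hj
        rw [if_neg (by omega), mul_zero, map_zero]
      · intro hj
        rw [Finset.mem_range] at hj
        omega

/-- The effect of `[z^{m-l}] γ(1/z, a - b)` on a product of Schur functions. -/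
lemma gammaInvMulHom_schurFun_mul {a b : ℕ+ → MvPowerSeries σ K}
    (hab : ∀ k : ℕ+, (a - b) k ∈ homog K w k) {u : ℕ+ → MvPowerSeries (Option σ) K}
    (hu : IsPowerSeq u (X none)) (m l : ℤ) (f : Maya m) (g : Maya (l + 1))
    (v : MvPowerSeries σ K) :
    gammaInvMulHom hab (m - l)
        (f.schurFun ((fun k => rename some (a k)) - u) *
          g.schurFun ((fun k => rename some (b k)) + u) * rename some v) =
      v * ∑ᶠ x : {x : Transfer m l // x.source = (f, g)},
        Transfer.sign (MvPowerSeries σ K) x.1 *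
          (x.1.target.1.schurFun a * x.1.target.2.schurFun b) := by
  obtain ⟨N, hN⟩ := f.2.2
  obtain ⟨M, hMN, hMg, hMf⟩ := Transfer.exists_bound f g N
  -- The largest term of `g` is the first, so it bounds the degree in z of s_g(b + {z}).
  obtain ⟨K', hK⟩ : ∃ K' : ℕ, ∀ q ≤ M, g.1 q - (l + 1) < K' :=
    ⟨(g.1 0 - (l + 1) + 1).toNat, fun q _ => by
      have := g.2.1.antitone (Nat.zero_le q)
      omega⟩
  rw [Transfer.finsum_schurFun_mul a b f g N hN M hMN hMg hMf K' hK,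
    f.schurFun_eq_detH _ hN, g.schurFun_eq_detH _ (N := M + 1) (fun i hi => hMg i (by omega)),
    detH_sub_powerSeq _ hu, detH_add_powerSeq _ hu l M g.1 K' hK]
  rw [Finset.sum_mul_sum]
  simp only [Finset.sum_mul, Finset.mul_sum, map_sum]
  refine Finset.sum_congr rfl fun j _ => Finset.sum_congr rfl fun r _ => ?_
  have h3 : (-X none) ^ (j : ℕ) * minorH (fun k => rename some (a k)) m N f.1 j *
      (X none ^ r * colH (fun k => rename some (b k)) l M g.1 r) * rename some v =
      X none ^ ((j : ℕ) + r) * rename some ((-1) ^ (j : ℕ) * minorH a m N f.1 j *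
        colH b l M g.1 r * v) := by
    rw [map_mul, map_mul, map_mul, map_pow, map_neg, map_one, map_minorH, map_colH, neg_pow, pow_add]
    ring
  rw [h3, gammaInvMulHom_X_pow_mul_rename]
  push_cast
  ring

end ZCoeff

/-- Used to regroup one sum over transfers by source or by target. Summability of `T` is a separate
input because convergence of the grouped sums alone does not imply it. -/
lemma hasSum_of_finite_fibers {α β R : Type*} [AddCommMonoid R] [TopologicalSpace R]
    [ContinuousAdd R] [T3Space R] (p : α → β) [∀ y, Finite {x // p x = y}] {T : α → R}
    {F : β → R} {s : R} (hT : Summable T) (h : ∀ y, ∑ᶠ x : {x // p x = y}, T x = F y)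
    (hF : HasSum F s) : HasSum T s := by
  rw [← (Equiv.sigmaFiberEquiv p).hasSum_iff]
  refine HasSum.sigma_of_hasSum hF (fun y => ?_) ((Equiv.sigmaFiberEquiv p).summable_iff.mpr hT)
  have := Fintype.ofFinite {x // p x = y}
  rw [← h y, finsum_eq_sum_of_fintype]
  exact hasSum_fintype _

/-! ### Invariance of the condition on X under transfers. -/

section Indicator

variable {m l : ℤ} (R : Type*) [CommRing R] (X : Set ℚ)

lemma indicator_mul (S T : Set ℤ) :
    indicator R X S * indicator R X T = indicator R X (S ∩ T) := by
  classical
  have hinj : Function.Injective fun k : ℤ => (k : ℚ) - 1 / 2 := fun i j h => by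
    have h' : (i : ℚ) - 1 / 2 = j - 1 / 2 := h
    exact_mod_cast sub_left_injective h'
  unfold indicator
  rw [Set.image_inter hinj, Set.subset_inter_iff]
  split_ifs <;> simp_all

/-- Containment in both sequences depends only on their intersection, and the moved element lies in
the intersection neither before nor after the move. -/
lemma indicator_source_eq_target (x : Transfer m l) :
    indicator R X (Set.range x.source.1.1) * indicator R X (Set.range x.source.2.1) =
      indicator R X (Set.range x.target.1.1) * indicator R X (Set.range x.target.2.1) := by
  rw [indicator_mul, indicator_mul]
  congr 1
  rw [Transfer.source, Transfer.target, Maya.range_erase, Maya.range_erase, ← x.2]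
  ext k
  simp only [Set.mem_inter_iff, Set.mem_sdiff]
  tauto

end Indicator

/-! ### Summability of the common expansion over transfers. -/

section Summability

variable {σ K : Type*} [Field K] [CharZero K] {w w' : σ → ℕ} {m l : ℤ}

lemma finite_maya_card_le (m : ℤ) (n : ℕ) : {f : Maya m | f.diagram.card ≤ n}.Finite :=
  (finite_card_le n).preimage (Maya.equivDiagram m).symm.injective.injOn

lemma schurFun_mem_homog {t : ℕ+ → MvPowerSeries σ K} (ht : ∀ k : ℕ+, t k ∈ homog K w k)
    (f : Maya m) : f.schurFun t ∈ homog K w f.diagram.card :=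
  schur_mem_homog t ht _

/-- A family that is indexed by pairs of sequences, with finite fibers, is summable if its members
are multiples of series whose degrees are those of the pairs. -/
lemma formallySummable_of_pairs {α : Type*} (p : α → Maya m × Maya l)
    [hp : ∀ y, Finite {x // p x = y}] {T : α → MvPowerSeries σ K}
    (u v : α → MvPowerSeries σ K)
    (hv : ∀ x, v x ∈ homog K w ((p x).1.diagram.card + (p x).2.diagram.card))
    (hT : ∀ x, T x = u x * v x) : FormallySummable T := by
  intro d
  refine (((finite_maya_card_le m (Finsupp.weight w d)).prod
    (finite_maya_card_le l (Finsupp.weight w d))).preimage' (f := p) fun y _ =>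
      Set.finite_coe_iff.mp (hp y)).subset fun x hx => ?_
  have hx' : coeff d (u x * v x) ≠ 0 := by
    rw [← hT]
    exact hx
  have := le_weight_of_coeff_mul_ne_zero (hv x) hx'
  rw [Set.mem_preimage, Set.mem_prod, Set.mem_ofPred_eq, Set.mem_ofPred_eq]
  omega

/-- The expansion of both sides of the Hirota equations. -/
noncomputable def hirotaTerm (X : Set ℚ) (a a' b b' : ℕ+ → MvPowerSeries σ K)
    (x : Transfer m l) : MvPowerSeries σ K :=
  indicator _ X (Set.range x.source.1.1) * indicator _ X (Set.range x.source.2.1) *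
    (x.source.1.schurFun a' * x.source.2.schurFun b') *
    (x.sign _ * (x.target.1.schurFun a * x.target.2.schurFun b))

lemma hirotaTerm_swap (X : Set ℚ) (a a' b b' : ℕ+ → MvPowerSeries σ K) (x : Transfer m l) :
    hirotaTerm X b' b a' a (Transfer.swap m l x) = hirotaTerm X a a' b b' x := by
  unfold hirotaTerm
  rw [indicator_source_eq_target _ X x, Transfer.source_swap, Transfer.target_swap,
    Transfer.sign_swap]
  simp only [Prod.fst_swap, Prod.snd_swap]
  ring

/-- The factor s_f(a') s_g(b') of the source alone has degree |f| + |g|; finitely many pairs have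
bounded degree, and each is the source of finitely many transfers. -/
lemma summable_hirotaTerm [TopologicalSpace K] (X : Set ℚ) (a : ℕ+ → MvPowerSeries σ K)
    {a' : ℕ+ → MvPowerSeries σ K} (b : ℕ+ → MvPowerSeries σ K) {b' : ℕ+ → MvPowerSeries σ K}
    (ha' : ∀ k : ℕ+, a' k ∈ homog K w' k) (hb' : ∀ k : ℕ+, b' k ∈ homog K w' k) :
    Summable (hirotaTerm (m := m) (l := l) X a a' b b') := by
  refine FormallySummable.hasSum (formallySummable_of_pairs Transfer.source
    (fun x => indicator _ X (Set.range x.source.1.1) * indicator _ X (Set.range x.source.2.1) *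
      (x.sign _ * (x.target.1.schurFun a * x.target.2.schurFun b)))
    (fun x => x.source.1.schurFun a' * x.source.2.schurFun b')
    (fun x => mul_mem_homog (schurFun_mem_homog ha' _) (schurFun_mem_homog hb' _)) fun x => ?_) |>.summable
  rw [hirotaTerm]
  ring

end Summability

/-! ### The Hirota equations. -/

section Hirota

variable {σ K : Type*} [Field K] [CharZero K] [UniformSpace K] [DiscreteUniformity K]
  {w w' : σ → ℕ} {v : Option σ → ℕ} {m l : ℤ}

lemma evalAt_correlationTau_comm {τ : Type*} {w : τ → ℕ} {a b : ℕ+ → MvPowerSeries τ K}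
    (ha : ∀ k : ℕ+, a k ∈ homog K w k) (hb : ∀ k : ℕ+, b k ∈ homog K w k) (X : Set ℚ) (n : ℤ) :
    evalAt (correlationTau K X n) a b = evalAt (correlationTau K X n) b a := by
  refine (hasSum_evalAt_correlationTau ha hb X n).unique ?_
  simp only [mul_comm (Maya.schurFun a _)]
  exact hasSum_evalAt_correlationTau hb ha X n

/-- Multiply the expansions of the two τ-functions and extract the coefficient termwise: each source
pair contributes the sum over its transfers. The sequences a', b' do not involve z and pass through
as constants. -/
lemma hasSum_hirotaTerm (X : Set ℚ) {a a' b b' : ℕ+ → MvPowerSeries σ K}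
    {u : ℕ+ → MvPowerSeries (Option σ) K} (hu : IsPowerSeq u (MvPowerSeries.X none))
    (hab : ∀ k : ℕ+, (a - b) k ∈ homog K w k)
    (ha' : ∀ k : ℕ+, a' k ∈ homog K w' k) (hb' : ∀ k : ℕ+, b' k ∈ homog K w' k)
    (va : ∀ k : ℕ+, ((fun k => rename some (a k)) - u) k ∈ homog K v k)
    (vb : ∀ k : ℕ+, ((fun k => rename some (b k)) + u) k ∈ homog K v k)
    (va' : ∀ k : ℕ+, rename some (a' k) ∈ homog K v k)
    (vb' : ∀ k : ℕ+, rename some (b' k) ∈ homog K v k) :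
    HasSum (hirotaTerm (m := m) (l := l) X a a' b b')
      (gammaInvMulCoeff (m - l) (a - b)
        (evalAt (correlationTau K X m) ((fun k => rename some (a k)) - u)
          (fun k => rename some (a' k)) *
        evalAt (correlationTau K X (l + 1)) ((fun k => rename some (b k)) + u)
          (fun k => rename some (b' k)))) := by
  have := nonarchimedeanRing_mvPowerSeries (σ := Option σ) (K := K)
  have h1 := ((hasSum_evalAt_correlationTau va va' X m).mul_of_nonarchimedean
    (hasSum_evalAt_correlationTau vb vb' X (l + 1))).map (gammaInvMulHom hab (m - l))
      (continuous_gammaInvMulHom hab (m - l))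
  refine hasSum_of_finite_fibers Transfer.source (summable_hirotaTerm X a b ha' hb')
    (fun y => ?_) h1
  obtain ⟨f, g⟩ := y
  have h2 := gammaInvMulHom_schurFun_mul hab hu m l f g
    (indicator _ X (Set.range f.1) * indicator _ X (Set.range g.1) *
      (f.schurFun a' * g.schurFun b'))
  rw [mul_finsum] at h2
  rw [finsum_congr fun x : {x : Transfer m l // x.source = (f, g)} => by
    rw [hirotaTerm, x.2], ← h2, Function.comp_apply]
  congr 1
  rw [map_mul, map_mul, map_mul, map_schurFun, map_schurFun, map_indicator, map_indicator]
  ring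

end Hirota

section HirotaVariables

variable {K : Type*} [Field K] [CharZero K]

/-- The weights of the variables in which every sequence has degrees `1, 2, …`. -/
def hirotaDegree : HirotaVar → ℕ
  | .t k => k
  | .t' k => k
  | .s k => k
  | .s' k => k

/-- The same weights, with `deg z = 1`. -/
def zDegree : Option HirotaVar → ℕ
  | none => 1
  | some i => hirotaDegree i

lemma tSeq_mem (k : ℕ+) : tSeq K k ∈ homog K zDegree k := X_mem_homog zDegree (some (.t k))
lemma tSeq'_mem (k : ℕ+) : tSeq' K k ∈ homog K zDegree k := X_mem_homog zDegree (some (.t' k))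
lemma sSeq_mem (k : ℕ+) : sSeq K k ∈ homog K zDegree k := X_mem_homog zDegree (some (.s k))
lemma sSeq'_mem (k : ℕ+) : sSeq' K k ∈ homog K zDegree k := X_mem_homog zDegree (some (.s' k))

lemma zSeq_mem (k : ℕ+) : zSeq K k ∈ homog K zDegree k := by
  intro d hd
  refine (show (X none ^ (k : ℕ) : MvPowerSeries (Option HirotaVar) K) ∈ homog K zDegree k from ?_)
    d fun h0 => hd ?_
  · have h := prod_mem_homog (w := zDegree) (Finset.range k)
      (fun _ => (X none : MvPowerSeries (Option HirotaVar) K)) (fun _ => 1)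
      fun _ _ => X_mem_homog zDegree none
    simpa using h
  · rw [zSeq, map_smul, h0, smul_zero]

lemma isPowerSeq_zSeq : IsPowerSeq (zSeq K) (X none) := by
  intro k
  have hk : ((k : ℕ) : K) ≠ 0 := Nat.cast_ne_zero.mpr k.ne_zero
  rw [zSeq, ← nsmul_eq_mul, ← Nat.cast_smul_eq_nsmul K, smul_smul, mul_inv_cancel₀ hk, one_smul]

theorem satisfiesTodaHirota_correlationTau (X : Set ℚ) :
    SatisfiesTodaHirota (correlationTau K X) := by
  -- The equation itself involves no topology; with `K` discrete, convergence expresses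
  -- coefficientwise stabilization.
  let _ : UniformSpace K := ⊥
  have : DiscreteUniformity K := ⟨rfl⟩
  intro m l
  let a : ℕ+ → MvPowerSeries HirotaVar K := fun k => .X (.t k) + .X (.s k)
  let a' : ℕ+ → MvPowerSeries HirotaVar K := fun k => .X (.t' k) + .X (.s' k)
  let b : ℕ+ → MvPowerSeries HirotaVar K := fun k => .X (.t k) - .X (.s k)
  let b' : ℕ+ → MvPowerSeries HirotaVar K := fun k => .X (.t' k) - .X (.s' k)
  have hX : ∀ i, (MvPowerSeries.X i : MvPowerSeries HirotaVar K) ∈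
      homog K hirotaDegree (hirotaDegree i) := X_mem_homog hirotaDegree
  have ha : ∀ k : ℕ+, a k ∈ homog K hirotaDegree k := fun k => add_mem (hX (.t k)) (hX (.s k))
  have ha' : ∀ k : ℕ+, a' k ∈ homog K hirotaDegree k := fun k => add_mem (hX (.t' k)) (hX (.s' k))
  have hb : ∀ k : ℕ+, b k ∈ homog K hirotaDegree k := fun k => sub_mem (hX (.t k)) (hX (.s k))
  have hb' : ∀ k : ℕ+, b' k ∈ homog K hirotaDegree k := fun k => sub_mem (hX (.t' k)) (hX (.s' k))
  have ra : (fun k => rename some (a k)) = tSeq K + sSeq K := by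
    funext k
    simp only [a, map_add, rename_X]
    rfl
  have ra' : (fun k => rename some (a' k)) = tSeq' K + sSeq' K := by
    funext k
    simp only [a', map_add, rename_X]
    rfl
  have rb : (fun k => rename some (b k)) = tSeq K - sSeq K := by
    funext k
    simp only [b, map_sub, rename_X]
    rfl
  have rb' : (fun k => rename some (b' k)) = tSeq' K - sSeq' K := by
    funext k
    simp only [b', map_sub, rename_X]
    rfl
  have va : ∀ k : ℕ+, (tSeq K + sSeq K) k ∈ homog K zDegree k := fun k =>
    add_mem (tSeq_mem k) (sSeq_mem k)
  have va' : ∀ k : ℕ+, (tSeq' K + sSeq' K) k ∈ homog K zDegree k := fun k =>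
    add_mem (tSeq'_mem k) (sSeq'_mem k)
  have vb : ∀ k : ℕ+, (tSeq K - sSeq K) k ∈ homog K zDegree k := fun k =>
    sub_mem (tSeq_mem k) (sSeq_mem k)
  have vb' : ∀ k : ℕ+, (tSeq' K - sSeq' K) k ∈ homog K zDegree k := fun k =>
    sub_mem (tSeq'_mem k) (sSeq'_mem k)
  have h1 := hasSum_hirotaTerm (m := m) (l := l) (v := zDegree) X isPowerSeq_zSeq
    (fun k => sub_mem (ha k) (hb k)) ha' hb'
    (fun k => sub_mem (ra ▸ va k) (zSeq_mem k)) (fun k => add_mem (rb ▸ vb k) (zSeq_mem k))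
    (fun k => (congrFun ra' k) ▸ va' k) (fun k => (congrFun rb' k) ▸ vb' k)
  -- The same expansion with t and t' exchanged and the pair of τ-functions in reverse order; its
  -- transfers from (l, m+1) to (l+1, m) are the inverses of those in `h1`.
  have h2 := hasSum_hirotaTerm (m := l) (l := m) (v := zDegree) X isPowerSeq_zSeq
    (fun k => sub_mem (hb' k) (ha' k)) hb ha
    (fun k => sub_mem (rb' ▸ vb' k) (zSeq_mem k)) (fun k => add_mem (ra' ▸ va' k) (zSeq_mem k))
    (fun k => (congrFun rb k) ▸ vb k) (fun k => (congrFun ra k) ▸ va k)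
  rw [← (Transfer.swap m l).hasSum_iff] at h2
  have h3 : hirotaTerm X b' b a' a ∘ Transfer.swap m l = hirotaTerm X a a' b b' :=
    funext fun x => hirotaTerm_swap X a a' b b' x
  rw [h3] at h2
  have h4 := h2.unique h1
  rw [ra, ra', rb, rb'] at h4
  have hs : (fun k => (2 : ℤ) • MvPowerSeries.X (HirotaVar.s k)) = a - b := by
    funext k
    simp only [a, b, Pi.sub_apply, two_smul]
    abel
  have hs' : (fun k => (-2 : ℤ) • MvPowerSeries.X (HirotaVar.s' k)) = b' - a' := by
    funext k
    simp only [a', b', Pi.sub_apply, neg_smul, two_smul]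
    abel
  have h5 := evalAt_correlationTau_comm (a := tSeq' K - sSeq' K - zSeq K)
    (fun k => sub_mem (vb' k) (zSeq_mem k)) vb X l
  have h6 := evalAt_correlationTau_comm (a := tSeq' K + sSeq' K + zSeq K)
    (fun k => add_mem (va' k) (zSeq_mem k)) va X (m + 1)
  rw [hs, hs', ← h4, h5, h6, mul_comm]

end HirotaVariables

/-! ### Infinitesimal bilinear identities over the dual numbers. -/

section DualNumbers

variable {R A : Type*} [CommRing R] [CommRing A] [Algebra R A]

/-- The ring homomorphism `f ↦ f + D(f) ε` into the dual numbers. -/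
def derivHom (D : Derivation R A A) : A →+* TrivSqZeroExt A A where
  toFun f := TrivSqZeroExt.inl f + TrivSqZeroExt.inr (D f)
  map_one' := by simp
  map_mul' f g := by
    ext
    · simp
    · simp
      ring
  map_zero' := by simp
  map_add' f g := by
    ext
    · simp
    · simp

@[simp]
lemma snd_derivHom (D : Derivation R A A) (f : A) : (derivHom D f).snd = D f := by
  simp [derivHom]

@[simp]
lemma fst_derivHom (D : Derivation R A A) (f : A) : (derivHom D f).fst = f := by
  simp [derivHom]

lemma snd_eps_pow_mul_inl (n : ℕ) (x : A) :
    ((TrivSqZeroExt.inr 1 : TrivSqZeroExt A A) ^ n * TrivSqZeroExt.inl x).snd =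
      if n = 1 then x else 0 := by
  rcases n with _ | _ | n
  · simp
  · simp
  · rw [pow_succ, pow_succ, mul_assoc (_ ^ n), TrivSqZeroExt.inr_mul_inr]
    simp

variable (A) in
/-- The sequence `(ε, 0, 0, …) = {ε}` of dual numbers. -/
def epsSeq (k : ℕ+) : TrivSqZeroExt A A := if k = 1 then TrivSqZeroExt.inr 1 else 0

lemma isPowerSeq_epsSeq : IsPowerSeq (epsSeq A) (TrivSqZeroExt.inr 1) := by
  intro k
  by_cases hk : k = 1
  · subst hk
    simp [epsSeq]
  · have hk2 : (k : ℕ) ≠ 1 := fun h => hk (PNat.eq h)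
    obtain ⟨n, hn⟩ : ∃ n, (k : ℕ) = n + 2 := ⟨k - 2, by have := k.pos; omega⟩
    rw [epsSeq, if_neg hk, mul_zero, hn, pow_succ, pow_succ, mul_assoc, TrivSqZeroExt.inr_mul_inr,
      mul_zero]

variable {D : Derivation R A A} {t : ℕ+ → A}

/-- Differentiating in the first time is translating by {ε}, so the determinant expansions with w =
ε compute derivatives of Schur functions. -/
lemma derivHom_comp_eq
    (hD : ∀ k, D (t k) = if k = 1 then 1 else 0) :
    (fun k => derivHom D (t k)) = (fun k => TrivSqZeroExt.inlHom A A (t k)) + epsSeq A := by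
  funext k
  by_cases hk : k = 1 <;> ext <;> simp [hD, epsSeq, hk]

lemma derivHom_neg_comp_eq
    (hD : ∀ k, D (t k) = if k = 1 then 1 else 0) :
    (fun k => derivHom (-D) (t k)) = (fun k => TrivSqZeroExt.inlHom A A (t k)) - epsSeq A := by
  funext k
  by_cases hk : k = 1 <;> ext <;> simp [hD, epsSeq, hk]

variable [Algebra ℚ A] {m l : ℤ}

lemma derivation_schurFun_eq_zero (D : Derivation R A A) {t : ℕ+ → A} (ht : ∀ k, D (t k) = 0)
    (f : Maya m) : D (f.schurFun t) = 0 := by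
  have h1 := map_schurFun (derivHom D) t f
  have h2 := map_schurFun (TrivSqZeroExt.inlHom A A) t f
  have h3 : (fun k => derivHom D (t k)) = fun k => TrivSqZeroExt.inlHom A A (t k) := by
    funext k
    ext <;> simp [ht]
  rw [h3, ← h2] at h1
  simpa using congrArg TrivSqZeroExt.snd h1

lemma completeHomog_zero (n : ℤ) : completeHomog (0 : ℕ+ → A) n = if n = 0 then 1 else 0 := by
  rcases lt_or_ge n 0 with hn | hn
  · rw [completeHomog_of_neg _ hn, if_neg hn.ne]
  · obtain ⟨n, rfl⟩ := Int.eq_ofNat_of_zero_le hn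
    have hu : IsPowerSeq (0 : ℕ+ → A) 0 := fun k => by simp
    rw [completeHomog_of_isPowerSeq hu, zero_pow_eq]
    simp

/-- The bilinear identity for a shift of the charges by `1`. -/
lemma finsum_schurFun_mul_eq_wronskian
    (hD : ∀ k, D (t k) = if k = 1 then 1 else 0) (f g : Maya (l + 1)) :
    ∑ᶠ x : {x : Transfer (l + 1) l // x.source = (f, g)},
        x.1.sign A * (x.1.target.1.schurFun t * x.1.target.2.schurFun t) =
      f.schurFun t * D (g.schurFun t) - D (f.schurFun t) * g.schurFun t := by
  obtain ⟨N, hN⟩ := f.2.2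
  obtain ⟨M, hMN, hMg, hMf⟩ := Transfer.exists_bound f g N
  obtain ⟨K, hK⟩ : ∃ K : ℕ, ∀ q ≤ M, g.1 q - (l + 1) < K :=
    ⟨(g.1 0 - (l + 1) + 1).toNat, fun q _ => by
      have := g.2.1.antitone (Nat.zero_le q)
      omega⟩
  rw [Transfer.finsum_schurFun_mul t t f g N hN M hMN hMg hMf K hK]
  have h1 : f.schurFun t * D (g.schurFun t) - D (f.schurFun t) * g.schurFun t =
      (derivHom (-D) (f.schurFun t) * derivHom D (g.schurFun t)).snd := by
    simp
    ring
  rw [h1, map_schurFun, map_schurFun, derivHom_comp_eq hD, derivHom_neg_comp_eq hD,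
    f.schurFun_eq_detH _ hN, g.schurFun_eq_detH _ (N := M + 1) (fun i hi => hMg i (by omega)),
    detH_sub_powerSeq _ isPowerSeq_epsSeq, detH_add_powerSeq _ isPowerSeq_epsSeq l M g.1 K hK,
    Finset.sum_mul_sum, TrivSqZeroExt.snd_sum]
  refine Finset.sum_congr rfl fun j _ => ?_
  rw [TrivSqZeroExt.snd_sum]
  refine Finset.sum_congr rfl fun r _ => ?_
  -- With a = b the factor is h_{j+r-1}(0), which selects j + r = 1, precisely the coefficient of ε.
  rw [← map_minorH, ← map_colH, sub_self, completeHomog_zero]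
  have h2 : (-TrivSqZeroExt.inr 1 : TrivSqZeroExt A A) ^ (j : ℕ) *
      TrivSqZeroExt.inlHom A A (minorH t (l + 1) N f.1 j) * (TrivSqZeroExt.inr 1 ^ r *
        TrivSqZeroExt.inlHom A A (colH t l M g.1 r)) =
      TrivSqZeroExt.inr 1 ^ ((j : ℕ) + r) * TrivSqZeroExt.inl ((-1) ^ (j : ℕ) *
        minorH t (l + 1) N f.1 j * colH t l M g.1 r) := by
    change _ = _ * TrivSqZeroExt.inlHom A A _
    rw [map_mul, map_mul, map_pow, map_neg, map_one, neg_pow, pow_add]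
    ring
  rw [h2, snd_eps_pow_mul_inl, mul_ite, mul_one, mul_zero]
  congr 1
  rw [eq_iff_iff]
  omega

/-- The infinitesimal bilinear identity for a shift of the charges by `-1`. -/
lemma finsum_derivation_schurFun_mul
    (hD : ∀ k, D (t k) = if k = 1 then 1 else 0) (f : Maya m) (g : Maya (m + 1 + 1)) :
    ∑ᶠ x : {x : Transfer m (m + 1) // x.source = (f, g)},
        x.1.sign A * (D (x.1.target.1.schurFun t) * x.1.target.2.schurFun t) =
      f.schurFun t * g.schurFun t := by
  obtain ⟨N, hN⟩ := f.2.2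
  obtain ⟨M, hMN, hMg, hMf⟩ := Transfer.exists_bound f g N
  obtain ⟨K, hK⟩ : ∃ K : ℕ, ∀ q ≤ M, g.1 q - (m + 1 + 1) < K :=
    ⟨(g.1 0 - (m + 1 + 1) + 1).toNat, fun q _ => by
      have := g.2.1.antitone (Nat.zero_le q)
      omega⟩
  -- Take a = t + {ε} and b = t. Then a - b = {ε}, a - {ε} = t and b + {ε} = a.
  have key := Transfer.finsum_schurFun_mul (fun k => derivHom D (t k))
    (fun k => TrivSqZeroExt.inlHom A A (t k)) f g N hN M hMN hMg hMf K hK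
  have hsum : ∑ j : Fin (N + 1), ∑ r ∈ Finset.range K, (-1) ^ (j : ℕ) *
      minorH (fun k => derivHom D (t k)) m N f.1 j *
      colH (fun k => TrivSqZeroExt.inlHom A A (t k)) (m + 1) M g.1 r *
      completeHomog ((fun k => derivHom D (t k)) - fun k => TrivSqZeroExt.inlHom A A (t k))
        ((j : ℕ) + (r : ℕ) - (m - (m + 1))) =
      TrivSqZeroExt.inr 1 * (TrivSqZeroExt.inlHom A A (f.schurFun t) *
        derivHom D (g.schurFun t)) := by
    have h1 := detH_sub_powerSeq (fun k => derivHom D (t k)) (isPowerSeq_epsSeq (A := A)) m N f.1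
    rw [← f.schurFun_eq_detH _ hN, derivHom_comp_eq hD, add_sub_cancel_right, ← map_schurFun,
      ← derivHom_comp_eq hD] at h1
    have h2 := detH_add_powerSeq (fun k => TrivSqZeroExt.inlHom A A (t k))
      (isPowerSeq_epsSeq (A := A)) (m + 1) M g.1 K hK
    rw [← g.schurFun_eq_detH _ (N := M + 1) (fun i hi => hMg i (by omega)),
      ← derivHom_comp_eq hD, ← map_schurFun] at h2
    rw [h1, h2, Finset.sum_mul_sum, Finset.mul_sum]
    refine Finset.sum_congr rfl fun j _ => ?_
    rw [Finset.mul_sum]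
    refine Finset.sum_congr rfl fun r _ => ?_
    -- The charge difference -1 gives the exponent j + r + 1; its extra ε leaves s_f s_g as the
    -- ε-coefficient of the whole sum.
    have h3 : completeHomog ((fun k => derivHom D (t k)) -
        fun k => TrivSqZeroExt.inlHom A A (t k)) ((j : ℕ) + (r : ℕ) - (m - (m + 1))) =
        TrivSqZeroExt.inr 1 ^ ((j : ℕ) + r + 1) := by
      rw [derivHom_comp_eq hD, add_sub_cancel_left,
        ← completeHomog_of_isPowerSeq (isPowerSeq_epsSeq (A := A))]
      congr 1
      push_cast
      ring
    rw [h3, neg_pow, pow_add, pow_add]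
    ring
  rw [hsum] at key
  have := Fintype.ofFinite {x : Transfer m (m + 1) // x.source = (f, g)}
  rw [finsum_eq_sum_of_fintype] at key ⊢
  have hsnd := congrArg TrivSqZeroExt.snd key
  rw [TrivSqZeroExt.snd_sum] at hsnd
  have hR : (TrivSqZeroExt.inr 1 * (TrivSqZeroExt.inlHom A A (f.schurFun t) *
      derivHom D (g.schurFun t))).snd = f.schurFun t * g.schurFun t := by
    simp
  rw [← hR, ← hsnd]
  refine Finset.sum_congr rfl fun x _ => ?_
  rw [← map_schurFun, ← map_schurFun]
  have hs : x.1.sign (TrivSqZeroExt A A) = TrivSqZeroExt.inlHom A A (x.1.sign A) := by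
    rw [Transfer.sign, Transfer.sign, map_mul, map_pow, map_pow, map_neg, map_one]
  rw [hs]
  simp

end DualNumbers

/-! ### The Toda equation in bilinear form. -/

section Toda

variable {σ K : Type*} [Field K]

lemma continuous_pderiv [TopologicalSpace K] [IsTopologicalRing K] (i : σ) :
    Continuous (pderiv K i) := by
  refine continuous_pi fun d => ?_
  have h : (fun F => pderiv K i F d) =
      fun F : MvPowerSeries σ K => coeff (d + Finsupp.single i 1) F * (d i + 1) :=
    funext fun F => coeff_pderiv F d
  rw [h]
  exact (WithPiTopology.continuous_coeff K _).mul continuous_const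

lemma derivation_indicator {A : Type*} [CommRing A] [Algebra K A] (D : Derivation K A A) (X : Set ℚ)
    (S : Set ℤ) : D (indicator A X S) = 0 := by
  unfold indicator
  split_ifs
  · exact D.map_one_eq_zero
  · exact map_zero D

/-- The variables `t`. -/
noncomputable def timeVar (K : Type*) [Field K] (k : ℕ+) : MvPowerSeries Time K := X (.t k)

/-- The variables `t'`. -/
noncomputable def timeVar' (K : Type*) [Field K] (k : ℕ+) : MvPowerSeries Time K := X (.t' k)

lemma dt_timeVar (k : ℕ+) : dt K (timeVar K k) = if k = 1 then 1 else 0 := by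
  split_ifs with h
  · subst h
    exact pderiv_X_self
  · exact pderiv_X_of_ne fun h' => h (Time.t.inj h')

lemma dt_timeVar' (k : ℕ+) : dt K (timeVar' K k) = 0 :=
  pderiv_X_of_ne (by simp)

lemma dt'_timeVar' (k : ℕ+) : dt' K (timeVar' K k) = if k = 1 then 1 else 0 := by
  split_ifs with h
  · subst h
    exact pderiv_X_self
  · exact pderiv_X_of_ne fun h' => h (Time.t'.inj h')

lemma dt'_timeVar (k : ℕ+) : dt' K (timeVar K k) = 0 :=
  pderiv_X_of_ne (by simp)

variable [CharZero K]

/-- The Toda equation in bilinear form. -/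
theorem correlationTau_toda_bilinear (X : Set ℚ) (n : ℤ) :
    correlationTau K X n * dt K (dt' K (correlationTau K X n)) -
        dt K (correlationTau K X n) * dt' K (correlationTau K X n) =
      correlationTau K X (n + 1) * correlationTau K X (n - 1) := by
  let _ : UniformSpace K := ⊥
  have : DiscreteUniformity K := ⟨rfl⟩
  have := nonarchimedeanRing_mvPowerSeries (σ := Time) (K := K)
  obtain ⟨l, rfl⟩ : ∃ l, n = l + 1 := ⟨n - 1, by ring⟩
  rw [add_sub_cancel_right]
  let I : ∀ {m : ℤ}, Maya m → MvPowerSeries Time K := fun f => indicator _ X (Set.range f.1)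
  let s : ∀ {m : ℤ}, Maya m → MvPowerSeries Time K := fun f => f.schurFun (timeVar K)
  let s' : ∀ {m : ℤ}, Maya m → MvPowerSeries Time K := fun f => f.schurFun (timeVar' K)
  have hs : ∀ {m : ℤ} (f : Maya m), dt' K (s f) = 0 := fun f =>
    derivation_schurFun_eq_zero (dt' K) dt'_timeVar f
  have hs' : ∀ {m : ℤ} (f : Maya m), dt K (s' f) = 0 := fun f =>
    derivation_schurFun_eq_zero (dt K) dt_timeVar' f
  have hI : ∀ {m : ℤ} (D : Derivation K (MvPowerSeries Time K) (MvPowerSeries Time K))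
      (f : Maya m), D (I f) = 0 := fun D f => derivation_indicator D X _
  have h0 : ∀ m, HasSum (fun f : Maya m => I f * (s f * s' f)) (correlationTau K X m) :=
    fun m => hasSum_correlationTau X m
  have h1 := (h0 (l + 1)).map (dt K) (continuous_pderiv _)
  have h2 := (h0 (l + 1)).map (dt' K) (continuous_pderiv _)
  have h3 := h2.map (dt K) (continuous_pderiv _)
  have e1 : ∀ f : Maya (l + 1), dt K (I f * (s f * s' f)) = I f * (dt K (s f) * s' f) := by
    intro f
    simp only [Derivation.leibniz, hI, hs', smul_eq_mul, mul_zero, zero_add, add_zero]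
    ring
  have e2 : ∀ f : Maya (l + 1), dt' K (I f * (s f * s' f)) = I f * (s f * dt' K (s' f)) := by
    intro f
    simp only [Derivation.leibniz, hI, hs, smul_eq_mul, mul_zero, add_zero]
  have hss : ∀ f : Maya (l + 1), dt K (dt' K (s' f)) = 0 := by
    intro f
    have hcomm : dt K (dt' K (s' f)) = dt' K (dt K (s' f)) := by
      ext d
      have h4 : Finsupp.single (Time.t 1) 1 (Time.t' 1) = 0 := Finsupp.single_eq_of_ne (by simp)
      have h5 : Finsupp.single (Time.t' 1) 1 (Time.t 1) = 0 := Finsupp.single_eq_of_ne (by simp)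
      simp only [coeff_pderiv, Finsupp.add_apply]
      rw [h4, h5, add_right_comm]
      push_cast
      ring
    rw [hcomm, hs', map_zero]
  have e3 : ∀ f : Maya (l + 1), dt K (I f * (s f * dt' K (s' f))) =
      I f * (dt K (s f) * dt' K (s' f)) := by
    intro f
    simp only [Derivation.leibniz, hI, hss, smul_eq_mul, mul_zero, zero_add, add_zero]
    ring
  have hL := ((h0 (l + 1)).mul_of_nonarchimedean h3).sub (h1.mul_of_nonarchimedean h2)
  have hR := (h0 (l + 1 + 1)).mul_of_nonarchimedean (h0 l)
  -- Both sides regroup this sum. Summing the unprimed factors over a fixed source gives s_f ∂s_g -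
  -- ∂s_f s_g; summing the primed factors over a fixed target gives s'_f s'_g.
  let T : Transfer (l + 1) l → MvPowerSeries Time K := fun x =>
    I x.source.1 * I x.source.2 * (s' x.source.1 * dt' K (s' x.source.2)) *
      (x.sign _ * (s x.target.1 * s x.target.2))
  have hT : Summable T := by
    refine FormallySummable.hasSum (formallySummable_of_pairs (w := tDegree) Transfer.target
      (fun x => I x.source.1 * I x.source.2 * (s' x.source.1 * dt' K (s' x.source.2)) * x.sign _)
      (fun x => s x.target.1 * s x.target.2)
      (fun x => mul_mem_homog (schurFun_mem_homog (fun k => X_mem_homog tDegree (Time.t k)) _)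
        (schurFun_mem_homog (fun k => X_mem_homog tDegree (Time.t k)) _)) fun x => ?_) |>.summable
    simp only [T]
    ring
  refine HasSum.unique (f := T) (hasSum_of_finite_fibers Transfer.source hT (fun y => ?_) hL)
    (hasSum_of_finite_fibers Transfer.target hT (fun y => ?_) hR)
  · obtain ⟨f, g⟩ := y
    have h := finsum_schurFun_mul_eq_wronskian (dt_timeVar (K := K)) f g
    rw [finsum_congr fun x : {x : Transfer (l + 1) l // x.source = (f, g)} => by
      simp only [T]; rw [x.2], ← mul_finsum, h]
    simp only [Function.comp_apply, e1, e2, e3]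
    change _ * (s f * dt K (s g) - dt K (s f) * s g) = _
    ring
  · obtain ⟨f, g⟩ := y
    have h := finsum_derivation_schurFun_mul (dt'_timeVar' (K := K)) g f
    have e : ∑ᶠ x : {x : Transfer (l + 1) l // x.target = (f, g)},
        x.1.sign _ * (s' x.1.source.1 * dt' K (s' x.1.source.2)) = s' g * s' f := by
      rw [← h]
      refine finsum_eq_of_bijective (fun x => ⟨Transfer.swap (l + 1) l x.1, by
        rw [Transfer.source_swap, x.2]; rfl⟩) ⟨fun x y h => ?_, fun y => ?_⟩ fun x => ?_
      · exact Subtype.ext ((Transfer.swap (l + 1) l).injective (congrArg Subtype.val h))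
      · refine ⟨⟨(Transfer.swap (l + 1) l).symm y.1, ?_⟩, Subtype.ext (Equiv.apply_symm_apply _ _)⟩
        have h1 := Transfer.source_swap ((Transfer.swap (l + 1) l).symm y.1)
        rw [Equiv.apply_symm_apply, y.2] at h1
        exact (Prod.swap_injective h1).symm
      · dsimp only
        rw [Transfer.sign_swap, Transfer.target_swap, mul_comm (s' _)]
        rfl
    rw [finsum_congr fun x : {x : Transfer (l + 1) l // x.target = (f, g)} => by
      have h1 : T x.1 = I f * I g * (s f * s g) *
          (x.1.sign _ * (s' x.1.source.1 * dt' K (s' x.1.source.2))) := by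
        have h2 := indicator_source_eq_target (MvPowerSeries Time K) X x.1
        simp only [T, I]
        rw [h2, x.2]
        ring
      exact h1, ← mul_finsum, e]
    ring

end Toda

/-! ### Logarithmic derivatives. -/

section Logarithm

variable {K : Type*} [Field K]

lemma mixedLogDeriv_eq {f : MvPowerSeries Time K} (hf : f ≠ 0) :
    mixedLogDeriv f =
      algebraMap _ (FractionRing (MvPowerSeries Time K)) (f * dt K (dt' K f) - dt K f * dt' K f) /
        algebraMap _ (FractionRing (MvPowerSeries Time K)) (f ^ 2) := by
  have hf' : algebraMap _ (FractionRing (MvPowerSeries Time K)) f ≠ 0 :=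
    (map_ne_zero_iff _ (IsFractionRing.injective _ _)).mpr hf
  rw [mixedLogDeriv, Derivation.leibniz_div, fracDeriv_algebraMap, fracDeriv_algebraMap,
    fracDeriv_algebraMap]
  simp only [smul_eq_mul, map_sub, map_mul, map_pow]
  field_simp

variable [CharZero K]

/-- `D(log f) = D(f) / f`. -/
lemma pderiv_logSeries_mul (i : Time) {f : MvPowerSeries Time K} (hf : constantCoeff f = 1) :
    pderiv K i (logSeries f) * f = pderiv K i f := by
  let _ : UniformSpace K := ⊥
  have : DiscreteUniformity K := ⟨rfl⟩
  obtain ⟨g, rfl⟩ : ∃ g, f = 1 + g := ⟨f - 1, by ring⟩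
  have hg : constantCoeff g = 0 := by simpa using hf
  have hg' : PowerSeries.HasSubst g := PowerSeries.HasSubst.of_constantCoeff_zero hg
  let c : ℕ → ℚ := fun n => PowerSeries.coeff n (PowerSeries.log ℚ)
  have hsum : FormallySummable fun n => c n • g ^ n := fun d => by
    refine (PowerSeries.coeff_subst_finite hg' (PowerSeries.log ℚ) d).subset fun n hn => ?_
    rwa [Function.mem_support, ← map_rat_smul (coeff (R := K) d)]
  have hlog : logSeries (1 + g) = formalSum fun n => c n • g ^ n := by
    rw [logSeries, add_sub_cancel_left]
    ext d
    rw [PowerSeries.coeff_subst hg']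
    refine finsum_congr fun n => ?_
    rw [map_rat_smul (coeff (R := K) d)]
  have h1 := hsum.hasSum.map (pderiv K i) (continuous_pderiv i)
  rw [← hlog, ← hasSum_nat_add_iff' 1] at h1
  -- Since c_{n+1} (n+1) = (-1)ⁿ, the differentiated logarithm becomes the geometric series Σ (-g)ⁿ
  -- ∂g, inverse to 1 + g up to the factor ∂g.
  have h2 : ∀ n, pderiv K i (c (n + 1) • g ^ (n + 1)) = (-g) ^ n * pderiv K i g := by
    intro n
    have hc : c (n + 1) * ((n + 1 : ℕ) : ℚ) = (-1) ^ n := by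
      have h0 : ((n + 1 : ℕ) : ℚ) ≠ 0 := Nat.cast_ne_zero.mpr n.succ_ne_zero
      simp only [c, PowerSeries.coeff_log, if_neg n.succ_ne_zero, Algebra.algebraMap_self,
        RingHom.id_apply]
      rw [div_mul_cancel₀ _ h0, pow_succ, pow_succ]
      ring
    rw [map_rat_smul (pderiv K i), pderiv_pow, Nat.add_sub_cancel, mul_assoc, ← nsmul_eq_mul,
      ← Nat.cast_smul_eq_nsmul ℚ, smul_smul, hc, neg_pow g, mul_assoc, Algebra.smul_def]
    simp
  simp only [Function.comp_apply, h2, Finset.sum_range_one, pow_zero] at h1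
  have hc0 : pderiv K i (c 0 • (1 : MvPowerSeries Time K)) = 0 := by
    rw [map_rat_smul (pderiv K i), pderiv_one, smul_zero]
  rw [hc0, sub_zero] at h1
  have hng : constantCoeff (-g) = 0 := by rw [map_neg, hg, neg_zero]
  have h3 := ((WithPiTopology.summable_pow_of_constantCoeff_eq_zero hng).hasSum).mul_right
    (pderiv K i g)
  have h4 := WithPiTopology.tsum_pow_mul_one_sub_of_constantCoeff_eq_zero hng
  rw [sub_neg_eq_add] at h4
  rw [h1.unique h3, mul_right_comm, h4, one_mul, map_add, pderiv_one, zero_add]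

lemma mixed_deriv_logSeries {f : MvPowerSeries Time K} (hf : constantCoeff f = 1) :
    dt K (dt' K (logSeries f)) =
      (f * dt K (dt' K f) - dt K f * dt' K f) * (f ^ 2)⁻¹ := by
  have h1 := pderiv_logSeries_mul (Time.t' 1) hf
  -- Differentiating f ∂'(log f) = ∂'f once more gives the mixed derivative by the product rule,
  -- without division.
  have h2 := congrArg (dt K) h1
  rw [Derivation.leibniz, smul_eq_mul, smul_eq_mul] at h2
  rw [MvPowerSeries.eq_mul_inv_iff_mul_eq (by rw [map_pow, hf]; simp), ← h2]
  linear_combination -(dt K f) * h1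

end Logarithm

end SchurToda

theorem mainTheorem3 {K : Type*} [Field K] [CharZero K] (X : Set ℚ) (hX : X ⊆ halfIntegers) :
    SatisfiesTodaHirota (correlationTau K X) ∧
    (∀ n : ℤ,
      correlationTau K X n * dt K (dt' K (correlationTau K X n)) -
          dt K (correlationTau K X n) * dt' K (correlationTau K X n) =
        correlationTau K X (n + 1) * correlationTau K X (n - 1)) ∧
    (∀ n : ℤ, correlationTau K X n ≠ 0 →
      mixedLogDeriv (correlationTau K X n) =
        algebraMap _ (FractionRing (MvPowerSeries Time K))
            (correlationTau K X (n + 1) * correlationTau K X (n - 1)) /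
          algebraMap _ (FractionRing (MvPowerSeries Time K)) (correlationTau K X n ^ 2)) ∧
    (∀ n : ℤ, MvPowerSeries.constantCoeff (correlationTau K X n) = 1 →
      dt K (dt' K (logSeries (correlationTau K X n))) =
        correlationTau K X (n + 1) * correlationTau K X (n - 1) *
          (correlationTau K X n ^ 2)⁻¹) := by
  refine ⟨satisfiesTodaHirota_correlationTau X, correlationTau_toda_bilinear X, fun n hn => ?_,
    fun n hn => ?_⟩
  · rw [mixedLogDeriv_eq hn, correlationTau_toda_bilinear]
  · rw [mixed_deriv_logSeries hn, correlationTau_toda_bilinear]
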